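/- **Setting.** Let $N,P,M$ be the dimensions, $\mathcal A\neq\emptyset$ a set of controls, $T>0$. For $\alpha\in\mathcal A$ let $\sigma^\alpha,b^\alpha,c^\alpha,f^\alpha$ be functions of $(t,x)\in\mathbb R\times\mathbb R^N$ (extended beyond $[0,T]$) with values in $\mathbb R^{N\times P},\mathbb R^N,\mathbb R,\mathbb R$, let $g:\mathbb R^N\to\mathbb R$, and, for a given $k\in(0,1)$, let $y_i^{\alpha,\pm}=y^{\alpha,\pm}_{k,i}:\mathbb R\times\mathbb R^N\to\mathbb R^N$, $i=1,\dots,M$. Write $|w|_0=\sup|w|$, $[w]_1=\sup_{(t,x)\ne(s,y)}\frac{|w(t,x)-w(s,y)|}{|x-y|+|t-s|^{1/2}}$, $|w|_1=|w|_0+[w]_1$ (Frobenius norm for matrices). Assume, for all $\alpha$ and all points $(t,x),(s,z)$: * (A1) $|g|_1+|\sigma^\alpha|_1+|b^\alpha|_1+|c^\alpha|_1+|f^\alpha|_1\le K$. * (Y1) $\sum_i[y_i^{\alpha,+}+y_i^{\alpha,-}]=2k^2b^\alpha+O(k^4)$, $\ \sum_i[y_i^{\alpha,+}\otimes y_i^{\alpha,+}+y_i^{\alpha,-}\otimes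 y_i^{\alpha,-}]=2k^2\sigma^\alpha\sigma^{\alpha\top}+O(k^4)$, $\ \sum_i[\otimes^jy_i^{\alpha,+}+\otimes^jy_i^{\alpha,-}]=O(k^4)$ for $j=3,4$, each component of each error being at most $K_Yk^4$ in absolute value. * (Y2) With $y,\sigma,b$ evaluated at $(t,x)$ and $\tilde y,\tilde\sigma,\tilde b$ denoting the same functions evaluated at $(s,z)$: componentwise $\sum_i\big([y_i^{\alpha,+}+y_i^{\alpha,-}]-[\tilde y_i^{\alpha,+}+\tilde y_i^{\alpha,-}]\big)\le 2k^2(b^\alpha-\tilde b^\alpha)$, and, in the sense of positive semidefinite matrices, $$\sum_i\sum_{\pm}\big[y_i^{\alpha,\pm}\otimes y_i^{\alpha,\pm}+\tilde y_i^{\alpha,\pm}\otimes\tilde y_i^{\alpha,\pm}-y_i^{\alpha,\pm}\otimes\tilde y_i^{\alpha,\pm}-\tilde y_i^{\alpha,\pm}\otimes y_i^{\alpha,\pm}\big]\le 2k^2(\sigma^\alpha-\tilde\sigma^\alpha)(\sigma^\alpha-\tilde\sigma^\alpha)^\top+2k^4(b^\alpha-\tilde b^\alpha)(b^\alpha-\tilde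 b^\alpha)^\top .$$ * (CFL) $\theta\in[0,1]$, $0<\Delta t\le T$, $(1-\theta)\Delta t\big[\frac M{k^2}-c^\alpha(t,x)\big]\le1$ and $\theta\Delta t\,c^\alpha(t,x)\le1$. * $2k_0\Delta t\le1$ and $2k_1\Delta t\le1$, where $k_0=\sup_\alpha|c^{\alpha,+}|_0$ (with $c^{\alpha,+}=\max(c^\alpha,0)$) and $k_1=2\sup_\alpha\{|\sigma^\alpha|_1^2+|b^\alpha|_1^2+1\}$. **Scheme.** Put $L_k^\alpha[\phi](r,x)=\sum_{i=1}^M\frac{\phi(x+y_i^{\alpha,+}(r,x))-2\phi(x)+\phi(x+y_i^{\alpha,-}(r,x))}{2k^2}$, $\delta_{\Delta t}V(t,x)=\frac{V(t,x)-V(t-\Delta t,x)}{\Delta t}$, $\bar V(t,x)=(1-\theta)V(t-\Delta t,x)+\theta V(t,x)$, $t^\theta=t-(1-\theta)\Delta t$. The scheme is $$(\mathrm S)\qquad \delta_{\Delta t}V(t,x)=\inf_{\alpha}\big\{L_k^\alpha[\bar V(t,\cdot)](t^\theta,x)+c^\alpha(t^\theta,x)\bar V(t,x)+f^\alpha(t^\theta,x)\big\},\quad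 t>\Delta t,$$ with $V(t,x)=(1-\frac t{\Delta t})g(x)+\frac t{\Delta t}V(\Delta t,x)$ on $[0,\Delta t]$, where $V(\Delta t,\cdot)$ is the first step of the discrete-time scheme started from $g$, that is, (S) holds also at $t=\Delta t$ with $V(0,\cdot)=g$. For $\varepsilon>0$ the scheme with shaken coefficients is obtained by replacing the right-hand side by $$\inf_{\alpha,\ 0\le s\le\varepsilon^2,\ |e|\le\varepsilon}\big\{L_k^\alpha[\bar V^\varepsilon(t,\cdot-e)](r+s,x+e)+c^\alpha(r+s,x+e)\bar V^\varepsilon(t,x)+f^\alpha(r+s,x+e)\big\},\quad r=t^\theta-\Delta t-\varepsilon^2 .$$ Let $V$ be the bounded continuous solution of (S) on $[0,T]\times\mathbb R^N$ and $V^\varepsilon$ the bounded continuous solution of the shaken scheme on $[0,T+\Delta t+\varepsilon^2]\times\mathbb R^N$. Let $\rho\in C^\infty(\mathbb R^{N+1})$, $\rho\ge0$, $\operatorname{supp}\rho\subset[0,1]\times\{|x|\le1\}$, $\int\rho=1$, $\rho_\varepsilon(t,x)=\varepsilon^{-N-2}\rho(t/\varepsilon^2,x/\varepsilon)$, and $$U_\varepsilon(t,x)=\int_{\mathbb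 R^N}\int_0^\infty V^\varepsilon(t-s+\Delta t+\varepsilon^2,x-e)\,\rho_\varepsilon(s,e)\,ds\,de .$$ **Proposition.** Let $\varepsilon_0>0$. There are constants $C$ and $C_{m,n}$ ($m,n\in\mathbb N_0$), depending only on $N,P,M,T,K,K_Y,\rho,\varepsilon_0$ (and on $m,n$), so independent of $k,\Delta t,\theta,\varepsilon$, such that for all data as above and all $0<\varepsilon\le\varepsilon_0$: (i) $U_\varepsilon\in C^\infty((-\Delta t,T)\times\mathbb R^N)$, $|U_\varepsilon|_1\le C$ on $[-\Delta t,T]\times\mathbb R^N$, and $|D^m\partial_t^nU_\varepsilon|\le C_{m,n}\,\varepsilon^{1-m-2n}$ on $(-\Delta t,T)\times\mathbb R^N$ for all $m,n\in\mathbb N_0$ with $m+n\ge1$. (ii) $|U_\varepsilon-V|\le C(\varepsilon+\Delta t^{1/2})$ on $[0,T]\times\mathbb R^N$. (iii) $U_\varepsilon$ is a subsolution of the scheme in $(0,T]\times\mathbb R^N$: $$\delta_{\Delta t}U_\varepsilon(t,x)\le\inf_{\alpha}\big\{L_k^\alpha[\bar U_\varepsilon(t,\cdot)](t^\theta,x)+c^\alpha(t^\theta,x)\bar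 U_\varepsilon(t,x)+f^\alpha(t^\theta,x)\big\}.$$ -/

import Mathlib

open Set MeasureTheory
open scoped ENNReal ContDiff Matrix.Norms.Frobenius

universe u

noncomputable section

/-- The space `ℝ^N` with its Euclidean norm. -/
abbrev Sp (N : ℕ) : Type := EuclideanSpace ℝ (Fin N)

/-! ### Norms -/

/-- `|w|_0`, the supremum of `|w|` over `Q`, as an extended nonnegative real. -/
def supNorm {N : ℕ} {F : Type*} [NormedAddCommGroup F] (Q : Set (ℝ × Sp N))
    (w : ℝ → Sp N → F) : ℝ≥0∞ :=
  ⨆ p ∈ Q, ‖w p.1 p.2‖ₑ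

/-- `[w]_1`, the Lipschitz seminorm over `Q` with respect to the parabolic distance
`|x - y| + |t - s|^{1/2}`. -/
def parSeminorm {N : ℕ} {F : Type*} [NormedAddCommGroup F] (Q : Set (ℝ × Sp N))
    (w : ℝ → Sp N → F) : ℝ≥0∞ :=
  ⨆ p ∈ Q, ⨆ q ∈ Q, ⨆ _ : p ≠ q,
    ‖w p.1 p.2 - w q.1 q.2‖ₑ / ENNReal.ofReal (‖p.2 - q.2‖ + √|p.1 - q.1|)

/-- `|w|_1 = |w|_0 + [w]_1`. -/
def parNorm {N : ℕ} {F : Type*} [NormedAddCommGroup F] (Q : Set (ℝ × Sp N))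
    (w : ℝ → Sp N → F) : ℝ≥0∞ :=
  supNorm Q w + parSeminorm Q w

/-! ### Data of the equation and of the scheme -/

/-- The coefficients `σ^α, b^α, c^α, f^α`, indexed by the controls `α ∈ A` and defined for all
times (that is, already extended beyond the time interval of the equation), and the initial
datum `g`. Matrices carry the Frobenius norm. -/
structure Coefficients (N P : ℕ) (A : Type u) where
  σ : A → ℝ → Sp N → Matrix (Fin N) (Fin P) ℝ
  b : A → ℝ → Sp N → Sp N
  c : A → ℝ → Sp N → ℝ
  f : A → ℝ → Sp N → ℝ
  g : Sp N → ℝ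

/-- The displacement fields `y^{α,+}_{k,i}` and `y^{α,-}_{k,i}`, `i = 1, …, M`, belonging to one
value of the parameter `k`. -/
structure Stencil (N M : ℕ) (A : Type u) where
  plus : A → Fin M → ℝ → Sp N → Sp N
  minus : A → Fin M → ℝ → Sp N → Sp N

/-- `|g|_1 + |σ^α|_1 + |b^α|_1 + |c^α|_1 + |f^α|_1 ≤ K` for all `α`. -/
def AssumptionA1 {N P : ℕ} {A : Type u} (D : Coefficients N P A) (K : ℝ) : Prop :=
  ∀ α, parNorm ({(0 : ℝ)} ×ˢ univ) (fun _ x => D.g x) + parNorm univ (D.σ α)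
    + parNorm univ (D.b α) + parNorm univ (D.c α) + parNorm univ (D.f α) ≤ ENNReal.ofReal K

/-- Consistency of the displacements with `σ` and `b`: the moments of order one to four agree with
`2k²b`, `2k²σσᵀ`, `0`, `0` up to errors of order `k⁴`, every component of the error being at
most `KY * k⁴`. -/
structure AssumptionY1 {N P M : ℕ} {A : Type u} (D : Coefficients N P A) (Y : Stencil N M A)
    (k KY : ℝ) : Prop where
  first : ∀ α t x (a : Fin N),
    |∑ i, (Y.plus α i t x a + Y.minus α i t x a) - 2 * k ^ 2 * D.b α t x a| ≤ KY * k ^ 4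
  second : ∀ α t x (a a' : Fin N),
    |∑ i, (Y.plus α i t x a * Y.plus α i t x a' + Y.minus α i t x a * Y.minus α i t x a')
      - 2 * k ^ 2 * (D.σ α t x * (D.σ α t x).transpose) a a'| ≤ KY * k ^ 4
  third : ∀ α t x (a₁ a₂ a₃ : Fin N),
    |∑ i, (Y.plus α i t x a₁ * Y.plus α i t x a₂ * Y.plus α i t x a₃
      + Y.minus α i t x a₁ * Y.minus α i t x a₂ * Y.minus α i t x a₃)| ≤ KY * k ^ 4
  fourth : ∀ α t x (a₁ a₂ a₃ a₄ : Fin N),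
    |∑ i, (Y.plus α i t x a₁ * Y.plus α i t x a₂ * Y.plus α i t x a₃ * Y.plus α i t x a₄
      + Y.minus α i t x a₁ * Y.minus α i t x a₂ * Y.minus α i t x a₃ * Y.minus α i t x a₄)|
      ≤ KY * k ^ 4

/-- `v ⊗ w = v wᵀ`. -/
def outer {N : ℕ} (v w : Sp N) : Matrix (Fin N) (Fin N) ℝ :=
  Matrix.of fun a a' => v a * w a'

/-- The covariance-type condition, for the data and all their translates in time and space: the
data without tilde are evaluated at `(t, x)`, those with tilde at `(s, z)`. The first inequality
is componentwise, the second one is in the sense of positive semidefinite matrices. -/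
structure AssumptionY2 {N P M : ℕ} {A : Type u} (D : Coefficients N P A) (Y : Stencil N M A)
    (k : ℝ) : Prop where
  mean : ∀ α t s x z (a : Fin N),
    ∑ i, ((Y.plus α i t x a + Y.minus α i t x a) - (Y.plus α i s z a + Y.minus α i s z a))
      ≤ 2 * k ^ 2 * (D.b α t x a - D.b α s z a)
  covariance : ∀ α t s x z,
    Matrix.PosSemidef
      (((2 * k ^ 2) • ((D.σ α t x - D.σ α s z) * (D.σ α t x - D.σ α s z).transpose)
        + (2 * k ^ 4) • outer (D.b α t x - D.b α s z) (D.b α t x - D.b α s z))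
      - ∑ i, ((outer (Y.plus α i t x) (Y.plus α i t x) + outer (Y.minus α i t x) (Y.minus α i t x))
          + (outer (Y.plus α i s z) (Y.plus α i s z) + outer (Y.minus α i s z) (Y.minus α i s z))
          - (outer (Y.plus α i t x) (Y.plus α i s z) + outer (Y.plus α i s z) (Y.plus α i t x)
            + outer (Y.minus α i t x) (Y.minus α i s z)
            + outer (Y.minus α i s z) (Y.minus α i t x))))

/-- The CFL conditions. -/
def CFL {N P : ℕ} {A : Type u} (D : Coefficients N P A) (M : ℕ) (k Δt θ : ℝ) : Prop :=
  ∀ α t x, (1 - θ) * Δt * ((M : ℝ) / k ^ 2 - D.c α t x) ≤ 1 ∧ θ * Δt * D.c α t x ≤ 1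

/-- `k_0 = sup_α |c^{α,+}|_0`. -/
def kZero {N P : ℕ} {A : Type u} (D : Coefficients N P A) : ℝ≥0∞ :=
  ⨆ α, supNorm univ (fun t x => max (D.c α t x) 0)

/-- `k_1 = 2 sup_α (|σ^α|_1² + |b^α|_1² + 1)`. -/
def kOne {N P : ℕ} {A : Type u} (D : Coefficients N P A) : ℝ≥0∞ :=
  2 * ⨆ α, (parNorm univ (D.σ α) ^ 2 + parNorm univ (D.b α) ^ 2 + 1)

/-! ### The schemes -/

/-- `L_k^α[φ](r, x)` for a function `φ` of the space variable. -/
def Lk {N M : ℕ} {A : Type u} (Y : Stencil N M A) (k : ℝ) (α : A) (φ : Sp N → ℝ)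
    (r : ℝ) (x : Sp N) : ℝ :=
  ∑ i, (φ (x + Y.plus α i r x) - 2 * φ x + φ (x + Y.minus α i r x)) / (2 * k ^ 2)

/-- `δ_{Δt} V(t, x) = (V(t, x) - V(t - Δt, x)) / Δt`. -/
def backDiff {N : ℕ} (Δt : ℝ) (V : ℝ → Sp N → ℝ) (t : ℝ) (x : Sp N) : ℝ :=
  (V t x - V (t - Δt) x) / Δt

/-- `(1 - θ) V(t - Δt, x) + θ V(t, x)`. -/
def thetaMean {N : ℕ} (θ Δt : ℝ) (V : ℝ → Sp N → ℝ) (t : ℝ) (x : Sp N) : ℝ :=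
  (1 - θ) * V (t - Δt) x + θ * V t x

/-- `t^θ = t - (1 - θ) Δt`. -/
def thetaTime (θ Δt t : ℝ) : ℝ := t - (1 - θ) * Δt

/-- Right-hand side of the scheme. -/
def schemeRHS {N P M : ℕ} {A : Type u} (D : Coefficients N P A) (Y : Stencil N M A)
    (k Δt θ : ℝ) (V : ℝ → Sp N → ℝ) (t : ℝ) (x : Sp N) : ℝ :=
  ⨅ α : A, (Lk Y k α (thetaMean θ Δt V t) (thetaTime θ Δt t) x
    + D.c α (thetaTime θ Δt t) x * thetaMean θ Δt V t x
    + D.f α (thetaTime θ Δt t) x)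

/-- Right-hand side of the scheme with shaken coefficients: the infimum runs over the controls
`α`, the time shifts `s ∈ [0, ε²]` and the space shifts `|e| ≤ ε`. -/
def shakenRHS {N P M : ℕ} {A : Type u} (D : Coefficients N P A) (Y : Stencil N M A)
    (k Δt θ ε : ℝ) (V : ℝ → Sp N → ℝ) (t : ℝ) (x : Sp N) : ℝ :=
  ⨅ q : A × Icc (0 : ℝ) (ε ^ 2) × Metric.closedBall (0 : Sp N) ε,
    (Lk Y k q.1 (fun z => thetaMean θ Δt V t (z - q.2.2))
        (thetaTime θ Δt t - Δt - ε ^ 2 + q.2.1) (x + q.2.2)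
      + D.c q.1 (thetaTime θ Δt t - Δt - ε ^ 2 + q.2.1) (x + q.2.2) * thetaMean θ Δt V t x
      + D.f q.1 (thetaTime θ Δt t - Δt - ε ^ 2 + q.2.1) (x + q.2.2))

/-- `V ∈ C_b([0, S] × ℝ^N)` solves `δ_{Δt} V = H[V]` on `(Δt, S] × ℝ^N` and, on `[0, Δt]`,
interpolates linearly between `g` and the first step `V(Δt, ·)` of the discrete-time scheme started
from `g`. That the value at `Δt` is this first step means that the equation holds also at
`t = Δt`. -/
structure IsSolution {N : ℕ} (H : (ℝ → Sp N → ℝ) → ℝ → Sp N → ℝ) (g : Sp N → ℝ) (Δt S : ℝ)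
    (V : ℝ → Sp N → ℝ) : Prop where
  continuousOn : ContinuousOn (fun p : ℝ × Sp N => V p.1 p.2) (Icc 0 S ×ˢ univ)
  bounded : ∃ B : ℝ, ∀ t ∈ Icc 0 S, ∀ x, |V t x| ≤ B
  equation : ∀ t ∈ Icc Δt S, ∀ x, backDiff Δt V t x = H V t x
  initial : ∀ t ∈ Icc 0 Δt, ∀ x, V t x = (1 - t / Δt) * g x + t / Δt * V Δt x

/-- `U` satisfies `δ_{Δt} U ≤ H[U]` on `(0, T] × ℝ^N`. -/
def IsSubsolution {N : ℕ} (H : (ℝ → Sp N → ℝ) → ℝ → Sp N → ℝ) (Δt T : ℝ)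
    (U : ℝ → Sp N → ℝ) : Prop :=
  ∀ t ∈ Ioc 0 T, ∀ x, backDiff Δt U t x ≤ H U t x

/-! ### Mollification -/

/-- `ρ ∈ C^∞(ℝ^{N+1})`, `ρ ≥ 0`, `supp ρ ⊆ [0, 1] × {|x| ≤ 1}`, `∫ ρ = 1`. -/
structure IsMollifier {N : ℕ} (ρ : ℝ × Sp N → ℝ) : Prop where
  smooth : ContDiff ℝ ∞ ρ
  nonneg : ∀ p, 0 ≤ ρ p
  support : tsupport ρ ⊆ Icc 0 1 ×ˢ Metric.closedBall 0 1
  integral : ∫ p, ρ p = 1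

/-- `ρ_ε(t, x) = ε^{-(N+2)} ρ(t / ε², x / ε)`. -/
def scaledMollifier {N : ℕ} (ρ : ℝ × Sp N → ℝ) (ε t : ℝ) (x : Sp N) : ℝ :=
  1 / ε ^ (N + 2) * ρ (t / ε ^ 2, ε⁻¹ • x)

/-- The function `U_ε`, built from `U^ε(t, x) = V^ε(t + Δt + ε², x)` by convolution with `ρ_ε`. -/
def mollifiedSolution {N : ℕ} (ρ : ℝ × Sp N → ℝ) (Δt ε : ℝ) (Vε : ℝ → Sp N → ℝ)
    (t : ℝ) (x : Sp N) : ℝ :=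
  ∫ e : Sp N, ∫ s in Ioi (0 : ℝ),
    Vε (t - s + Δt + ε ^ 2) (x - e) * scaledMollifier ρ ε s e

end

/-! ### A discrete maximum principle -/

/-! The proof is Krylov's shaking of the coefficients. At the point $(t-s+Δt+ε^2, x-e)$ the shaken
equation may use the shift $(s,e)$, which moves its coefficients exactly to $(t^θ,x)$. So, for a
fixed control, all translates of $V^ε$ that enter $U_ε$ satisfy the same linear difference
inequality, with coefficients independent of $(s,e)$. Averaging against $ρ_ε ≥ 0$ preserves it, and
the infimum over controls gives (iii); see `isSubsolution_mollifiedSolution`.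

Parts (i) and (ii) need regularity of $V^ε$ and closeness to $V$, uniformly in $k, Δt, θ, ε$. Both
functions solve a scheme of the form `shiftRHS`, whose coefficients are translated along with the
control, so each estimate is proved once. All estimates rest on one comparison argument,
`monotone_step_growth`: a subsolution of the linearised scheme stays below a geometrically growing
multiple of a barrier $ψ ≥ 0$, provided the difference operator maps $ψ$ to at most $C_1 ψ + e/4$.
The constant barrier bounds the solution. The barrier $l|x-z|^2 + 1/l$ in doubled variables
(`IsSolution.growth_pair`) gives the Lipschitz bound in space and the dependence on translations of
the coefficients. The same parabola around a fixed point gives the exponent $1/2$ in time.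

Assumption (Y2) makes $|x-z|^2$ admissible when both points move by displacements of the same
control. Constants matter here: the restrictions on the time step give $Δt\,C_1 ≤ 9/20$ and $Δt\,c^+
≤ 1/2$, and since the sum is below one, the implicit part of a step can be absorbed.

In variables scaled by $ε^2$ and $ε$ the mollification is a convolution with $ρ$, and $V^ε$
oscillates by $O(ε)$ over the support; this gives the powers of $ε$ in (i). For (ii), $U_ε - V^ε$ is
bounded by regularity, and $V^ε - V$ by comparing coefficients translated by at most $ε$ in space
and $Δt+ε^2$ in time. -/

/-- The sum of the difference quotients `(v (P i) - 2 v p + v (Q i)) / (2k²)`. -/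
noncomputable def diffSum {X : Type*} {M : ℕ} (k : ℝ) (v : X → ℝ) (P Q : Fin M → X) (p : X) : ℝ :=
  ∑ i, (v (P i) - 2 * v p + v (Q i)) / (2 * k ^ 2)

theorem diffSum_sub {X : Type*} {M : ℕ} (k : ℝ) (v w : X → ℝ) (P Q : Fin M → X) (p : X) :
    diffSum k (fun q => v q - w q) P Q p = diffSum k v P Q p - diffSum k w P Q p := by
  unfold diffSum
  rw [← Finset.sum_sub_distrib]
  exact Finset.sum_congr rfl fun i _ => by ring

theorem diffSum_const_mul_add {X : Type*} {M : ℕ} (k a b : ℝ) (v : X → ℝ) (P Q : Fin M → X)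
    (p : X) : diffSum k (fun q => a * v q + b) P Q p = a * diffSum k v P Q p := by
  unfold diffSum
  rw [Finset.mul_sum]
  exact Finset.sum_congr rfl fun i _ => by ring

theorem diffSum_le_of_le {X : Type*} {M : ℕ} {k m : ℝ} (hk : 0 < k) {v : X → ℝ}
    (P Q : Fin M → X) (p : X) (hv : ∀ q, v q ≤ m) :
    diffSum k v P Q p ≤ M / k ^ 2 * (m - v p) := by
  have h : ∀ i ∈ (Finset.univ : Finset (Fin M)),
      (v (P i) - 2 * v p + v (Q i)) / (2 * k ^ 2) ≤ (m - v p) / k ^ 2 := by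
    intro i _
    rw [div_le_div_iff₀ (by positivity) (by positivity)]
    have h1 := hv (P i)
    have h2 := hv (Q i)
    have : 0 < k ^ 2 := by positivity
    nlinarith
  refine (Finset.sum_le_sum h).trans (le_of_eq ?_)
  simp
  ring

/-- The maximum principle for one step of a monotone scheme: `v₀ ≤ 0` implies `v₁ ≤ 0`. -/
theorem nonpos_of_monotone_step {X : Type*} {M : ℕ} {k Δt θ Cb : ℝ} (hk : 0 < k) (hΔt : 0 < Δt)
    (hθ0 : 0 ≤ θ) (hθ1 : θ ≤ 1) {v₀ v₁ : X → ℝ} (hv₀ : ∀ p, v₀ p ≤ 0)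
    (hbd : BddAbove (range v₁))
    (step : ∀ p, ∀ η > 0, ∃ (P Q : Fin M → X) (c : ℝ), (1 - θ) * Δt * (M / k ^ 2 - c) ≤ 1 ∧
      Δt * c ≤ 1 / 2 ∧ |c| ≤ Cb ∧
      v₁ p - v₀ p ≤ Δt * (diffSum k (fun q => (1 - θ) * v₀ q + θ * v₁ q) P Q p
        + c * ((1 - θ) * v₀ p + θ * v₁ p)) + η) (p : X) : v₁ p ≤ 0 := by
  by_contra! hp
  set m := sSup (range v₁) with hm
  have hle : ∀ q, v₁ q ≤ m := fun q => le_csSup hbd ⟨q, rfl⟩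
  have hmpos : 0 < m := hp.trans_le (hle p)
  have hCb : 0 ≤ Cb := by
    obtain ⟨_, _, c, _, _, h, _⟩ := step p 1 one_pos
    exact (abs_nonneg c).trans h
  have hMk : (0 : ℝ) ≤ M / k ^ 2 := by positivity
  set L : ℝ := 1 + Δt * (M / k ^ 2 + Cb) with hL
  have hL1 : 1 ≤ L := by
    have : 0 ≤ Δt * (M / k ^ 2 + Cb) := by positivity
    linarith
  -- The supremum need not be attained, so the step is tested at a point within `η` of it. There it
  -- reduces to `m * (1 - θ * Δt * c) ≤ η + η * L`; the left side is at least `m / 2` and the right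
  -- side at most `m / 4`.
  set η := m / (8 * L) with hη
  have hηpos : 0 < η := by positivity
  have hηL : η * L = m / 8 := by rw [hη]; field_simp
  obtain ⟨_, ⟨q, rfl⟩, hq⟩ := exists_lt_of_lt_csSup (⟨_, ⟨p, rfl⟩⟩ : (range v₁).Nonempty)
    (sub_lt_self m hηpos)
  obtain ⟨P, Q, c, hcfl, hc, hcb, hstep⟩ := step q η hηpos
  have hθ1' : 0 ≤ 1 - θ := by linarith
  have hd := diffSum_le_of_le (M := M) hk (v := fun q => (1 - θ) * v₀ q + θ * v₁ q) (m := θ * m)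
    P Q q (fun q' => by
      have := mul_nonneg hθ1' (neg_nonneg.2 (hv₀ q'))
      have := mul_le_mul_of_nonneg_left (hle q') hθ0
      linarith)
  have h1 := mul_le_mul_of_nonneg_left hd hΔt.le
  beta_reduce at h1
  generalize (M : ℝ) / k ^ 2 = R at *
  have h2 : v₁ q * (1 + θ * Δt * (R - c)) ≤ v₀ q * (1 - (1 - θ) * Δt * (R - c))
      + Δt * R * θ * m + η := by nlinarith
  -- Monotonicity of the explicit part: the CFL condition makes the weight of the old value
  -- nonnegative.
  have h3 : v₀ q * (1 - (1 - θ) * Δt * (R - c)) ≤ 0 :=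
    mul_nonpos_of_nonpos_of_nonneg (hv₀ q) (by linarith)
  have hcθ : θ * (Δt * c) ≤ 1 / 2 := by
    rcases le_or_gt 0 c with h | h
    · nlinarith [mul_nonneg hΔt.le h]
    · have : Δt * c < 0 := mul_neg_of_pos_of_neg hΔt h
      nlinarith
  have hθR : 0 ≤ θ * Δt * R := by positivity
  have ha0 : 0 ≤ 1 + θ * Δt * (R - c) := by nlinarith
  have haL : 1 + θ * Δt * (R - c) ≤ L := by
    have h5 : R - c ≤ R + Cb := by linarith [neg_abs_le c]
    have h6 : θ * Δt * (R - c) ≤ θ * Δt * (R + Cb) :=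
      mul_le_mul_of_nonneg_left h5 (by positivity)
    have h7 : θ * (Δt * (R + Cb)) ≤ 1 * (Δt * (R + Cb)) :=
      mul_le_mul_of_nonneg_right hθ1 (by positivity)
    nlinarith
  have h8 : (m - η) * (1 + θ * Δt * (R - c)) ≤ v₁ q * (1 + θ * Δt * (R - c)) :=
    mul_le_mul_of_nonneg_right hq.le ha0
  have h9 : η * (1 + θ * Δt * (R - c)) ≤ η * L := mul_le_mul_of_nonneg_left haL hηpos.le
  have h10 : η ≤ η * L := by nlinarith
  have h11 : m * (θ * (Δt * c)) ≤ m * (1 / 2) := mul_le_mul_of_nonneg_left hcθ hmpos.le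
  nlinarith

/-- The barrier `b * Ψ` with growth `b ↦ b + r Δt (b + 1)` is a supersolution of one step. -/
theorem barrier_step {θ Δt r b c c' C₁ μ κ e ψ Ψ F Lψ : ℝ} (hΔt : 0 < Δt) (hθ0 : 0 ≤ θ)
    (hθ1 : θ ≤ 1) (hκ : 0 ≤ κ) (he : 0 ≤ e) (hμ : 0 ≤ μ) (hr : r = 20 * (μ + κ)) (hb : 1 ≤ b)
    (hc' : 0 ≤ c') (hcc : c ≤ c') (hc2 : Δt * c' ≤ 1 / 2) (hψ : 0 ≤ ψ) (hψΨ : ψ ≤ Ψ)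
    (hC₁ : 0 ≤ C₁) (hsm : Δt * (C₁ + c') ≤ 19 / 20) (hμ' : C₁ + c' ≤ μ)
    (hF : F ≤ κ * ψ + e / 4) (hL : Lψ ≤ C₁ * ψ + e / 4) :
    Δt * (((1 - θ) * b + θ * (b + r * Δt * (b + 1))) * Lψ
      + c * ((1 - θ) * (b * Ψ) + θ * ((b + r * Δt * (b + 1)) * (Ψ + Δt * e))) + F)
      ≤ (b + r * Δt * (b + 1)) * (Ψ + Δt * e) - b * Ψ := by
  have hr0 : 0 ≤ r := by rw [hr]; positivity
  have hrb : 0 ≤ r * Δt * (b + 1) := by positivity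
  obtain ⟨b', hbb'⟩ : ∃ b', b' = b + r * Δt * (b + 1) := ⟨_, rfl⟩
  rw [← hbb']
  have hb1' : 1 ≤ b' := by linarith
  have hΨ0 : 0 ≤ Ψ := hψ.trans hψΨ
  have hθ' : 0 ≤ 1 - θ := by linarith
  obtain ⟨bb, hbb⟩ : ∃ bb, bb = (1 - θ) * b + θ * b' := ⟨_, rfl⟩
  rw [← hbb]
  have hbb0 : 0 ≤ bb := by rw [hbb]; positivity
  have hbble : bb ≤ b' := by
    have := mul_le_mul_of_nonneg_left (show b ≤ b' by linarith) hθ'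
    rw [hbb]; linarith
  -- The increment `Δt * e` of the barrier pays for three errors: `e / 4` here, `e / 2` in the
  -- zeroth-order term (by `Δt * c' ≤ 1 / 2`) and `e / 4` in the source.
  have g1 : bb * Lψ ≤ bb * C₁ * Ψ + b' * (e / 4) := by
    have a1 := mul_le_mul_of_nonneg_left hL hbb0
    have a2 : bb * C₁ * ψ ≤ bb * C₁ * Ψ := mul_le_mul_of_nonneg_left hψΨ (by positivity)
    have a3 : bb * (e / 4) ≤ b' * (e / 4) := mul_le_mul_of_nonneg_right hbble (by positivity)
    linarith
  have g2 : c * ((1 - θ) * (b * Ψ) + θ * (b' * (Ψ + Δt * e))) ≤ c' * bb * Ψ + b' * e / 2 := by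
    have a1 := mul_le_mul_of_nonneg_right hcc
      (show 0 ≤ (1 - θ) * (b * Ψ) + θ * (b' * (Ψ + Δt * e)) by positivity)
    have a2 : (Δt * c') * (θ * (b' * e)) ≤ 1 / 2 * (1 * (b' * e)) := by
      apply mul_le_mul hc2 _ (by positivity) (by norm_num)
      exact mul_le_mul_of_nonneg_right hθ1 (by positivity)
    have a3 : c' * ((1 - θ) * (b * Ψ) + θ * (b' * (Ψ + Δt * e)))
        = c' * bb * Ψ + (Δt * c') * (θ * (b' * e)) := by rw [hbb]; ring
    linarith
  have g3 : F ≤ κ * Ψ + b' * (e / 4) := by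
    have a1 : κ * ψ ≤ κ * Ψ := mul_le_mul_of_nonneg_left hψΨ hκ
    have a2 : 1 * (e / 4) ≤ b' * (e / 4) := mul_le_mul_of_nonneg_right hb1' (by positivity)
    linarith
  -- The implicit part contributes `θ * r * (b + 1) * Δt * (C₁ + c')`, at most 19/20 of the
  -- right-hand side. The remaining twentieth has to cover `b * (C₁ + c') + κ`, which dictates `r =
  -- 20 * (μ + κ)`.
  have g4 : bb * (C₁ + c') + κ ≤ r * (b + 1) := by
    have a1 : bb = b + θ * (r * (b + 1)) * Δt := by rw [hbb, hbb']; ring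
    have a2 : b * (C₁ + c') ≤ b * μ := mul_le_mul_of_nonneg_left hμ' (by linarith)
    have a3 : (θ * (r * (b + 1))) * (Δt * (C₁ + c')) ≤ (1 * (r * (b + 1))) * (19 / 20) := by
      apply mul_le_mul _ hsm (by positivity) (by positivity)
      exact mul_le_mul_of_nonneg_right hθ1 (by positivity)
    have a4 : r * (b + 1) / 20 = (μ + κ) * (b + 1) := by rw [hr]; ring
    have a5 : bb * (C₁ + c') = b * (C₁ + c') + (θ * (r * (b + 1))) * (Δt * (C₁ + c')) := by
      rw [a1]; ring
    have a6 : 0 ≤ κ * b := mul_nonneg hκ (by linarith)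
    have a7 : (μ + κ) * (b + 1) = b * μ + κ * b + μ + κ := by ring
    linarith
  have g5 := mul_le_mul_of_nonneg_right g4 hΨ0
  have g6 : bb * Lψ + c * ((1 - θ) * (b * Ψ) + θ * (b' * (Ψ + Δt * e))) + F
      ≤ r * (b + 1) * Ψ + b' * e := by linarith
  have g7 := mul_le_mul_of_nonneg_left g6 hΔt.le
  have g8 : b' * (Ψ + Δt * e) - b * Ψ = Δt * (r * (b + 1) * Ψ + b' * e) := by
    rw [mul_add, hbb']; ring
  linarith

/-- Growth of the subsolutions `w n` of a monotone scheme against the barrier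
`B n * (ψ + n Δt e)`. -/
theorem monotone_step_growth {X : Type*} {M : ℕ} {k Δt θ Cb μ κ e B : ℝ} (hk : 0 < k)
    (hΔt : 0 < Δt) (hθ0 : 0 ≤ θ) (hθ1 : θ ≤ 1) (hκ : 0 ≤ κ) (he : 0 ≤ e) (hB : 1 ≤ B)
    (hμ : 0 ≤ μ)
    {ψ : X → ℝ} (hψ : ∀ p, 0 ≤ ψ p) {w : ℕ → X → ℝ} {n : ℕ}
    (hbd : ∀ m ≤ n, BddAbove (range (w m))) (h0 : ∀ p, w 0 p ≤ B * ψ p)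
    (step : ∀ m < n, ∀ p, ∀ η > 0, ∃ (P Q : Fin M → X) (c C₁ F : ℝ),
      (1 - θ) * Δt * (M / k ^ 2 - c) ≤ 1 ∧ Δt * c ≤ 1 / 2 ∧ |c| ≤ Cb ∧ 0 ≤ C₁ ∧
      Δt * (C₁ + max c 0) ≤ 19 / 20 ∧ C₁ + max c 0 ≤ μ ∧ F ≤ κ * ψ p + e / 4 ∧
      diffSum k ψ P Q p ≤ C₁ * ψ p + e / 4 ∧
      w (m + 1) p - w m p ≤ Δt * (diffSum k (fun q => (1 - θ) * w m q + θ * w (m + 1) q) P Q p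
        + c * ((1 - θ) * w m p + θ * w (m + 1) p) + F) + η) (p : X) :
    w n p ≤ ((B + 1) * (1 + 20 * (μ + κ) * Δt) ^ n - 1) * (ψ p + n * Δt * e) := by
  induction n generalizing p with
  | zero => simpa using h0 p
  | succ n ih =>
    have ih' := ih (fun m hm => hbd m (by omega)) (fun m hm => step m (by omega))
    clear ih
    obtain ⟨r, hr⟩ : ∃ r, r = 20 * (μ + κ) := ⟨_, rfl⟩
    rw [← hr] at ih' ⊢
    have hr0 : 0 ≤ r := by rw [hr]; positivity
    -- Closed form of the recursion `b ↦ b + r * Δt * (b + 1)` started at `B`.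
    set b := (B + 1) * (1 + r * Δt) ^ n - 1 with hb
    clear_value b
    have hpow : 1 ≤ (1 + r * Δt) ^ n := one_le_pow₀ (by nlinarith [mul_nonneg hr0 hΔt.le])
    have hb1 : 1 ≤ b := by nlinarith
    set b' := (B + 1) * (1 + r * Δt) ^ (n + 1) - 1 with hb'
    have hbb' : b' = b + r * Δt * (b + 1) := by rw [hb', hb, pow_succ]; ring
    clear_value b'
    have hb1' : 1 ≤ b' := by
      rw [hbb']; have : 0 ≤ r * Δt * (b + 1) := by positivity
      linarith
    set φ₀ : X → ℝ := fun p => b * ψ p + b * (n * Δt * e) with hφ₀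
    set φ₁ : X → ℝ := fun p => b' * ψ p + b' * ((n + 1) * Δt * e) with hφ₁
    have hφ₁0 : ∀ p, 0 ≤ φ₁ p := fun p => by
      have := hψ p
      simp only [hφ₁]; positivity
    have key := nonpos_of_monotone_step (M := M) (v₀ := fun p => w n p - φ₀ p)
      (v₁ := fun p => w (n + 1) p - φ₁ p) (Cb := Cb) hk hΔt hθ0 hθ1
      (fun p => by have := ih' p; simp only [hφ₀]; linarith) ?_ ?_ p
    · push_cast
      simp only [hφ₁] at key
      linarith
    · obtain ⟨Z, hZ⟩ := hbd (n + 1) le_rfl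
      refine ⟨Z, ?_⟩
      rintro _ ⟨q, rfl⟩
      have := hZ ⟨q, rfl⟩
      have := hφ₁0 q
      simp only; linarith
    · intro q η hη
      obtain ⟨P, Q, c, C₁, F, hcfl, hc, hcb, hC1, hsm, hμ', hF, hL, hs⟩ :=
        step n (by omega) q η hη
      refine ⟨P, Q, c, hcfl, hc, hcb, ?_⟩
      set bb := (1 - θ) * b + θ * b' with hbb
      -- The part of the barrier that is constant on `X` drops out of `diffSum`, so only the second
      -- differences of `ψ` have to be estimated.
      have e1 : (fun q => (1 - θ) * (w n q - φ₀ q) + θ * (w (n + 1) q - φ₁ q))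
          = fun q => ((1 - θ) * w n q + θ * w (n + 1) q)
            - (bb * ψ q + ((1 - θ) * (b * (n * Δt * e)) + θ * (b' * ((n + 1) * Δt * e)))) := by
        funext q; simp only [hφ₀, hφ₁, hbb]; ring
      rw [e1, diffSum_sub, diffSum_const_mul_add]
      have hc2 : Δt * max c 0 ≤ 1 / 2 := by
        rw [mul_max_of_nonneg _ _ hΔt.le, mul_zero]
        exact max_le hc (by norm_num)
      have key := barrier_step (b := b) hΔt hθ0 hθ1 hκ he hμ hr hb1 (le_max_right c 0)
        (le_max_left c 0) hc2 (hψ q)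
        (le_add_of_nonneg_right (by positivity) : ψ q ≤ ψ q + n * Δt * e) hC1 hsm hμ' hF hL
      have f0 : φ₀ q = b * (ψ q + n * Δt * e) := by simp only [hφ₀]; ring
      have f1 : φ₁ q = b' * (ψ q + n * Δt * e + Δt * e) := by simp only [hφ₁]; ring
      rw [f0, f1]
      rw [← hbb', ← hbb] at key
      linarith

/-! ### Bounds on the coefficients in terms of real numbers -/

theorem norm_le_of_supNorm_le {N : ℕ} {F : Type*} [NormedAddCommGroup F] {Q : Set (ℝ × Sp N)}
    {w : ℝ → Sp N → F} {K : ℝ} (hK : 0 ≤ K) (h : supNorm Q w ≤ ENNReal.ofReal K) {t : ℝ}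
    {x : Sp N} (hp : (t, x) ∈ Q) : ‖w t x‖ ≤ K := by
  have h1 : ‖w t x‖ₑ ≤ ENNReal.ofReal K :=
    (le_iSup₂ (f := fun (p : ℝ × Sp N) (_ : p ∈ Q) => ‖w p.1 p.2‖ₑ) (t, x) hp).trans h
  rwa [← ofReal_norm, ENNReal.ofReal_le_ofReal_iff hK] at h1

theorem norm_sub_le_of_parSeminorm_le {N : ℕ} {F : Type*} [NormedAddCommGroup F]
    {Q : Set (ℝ × Sp N)} {w : ℝ → Sp N → F} {K : ℝ} (hK : 0 ≤ K)
    (h : parSeminorm Q w ≤ ENNReal.ofReal K) {t s : ℝ} {x z : Sp N} (hp : (t, x) ∈ Q)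
    (hq : (s, z) ∈ Q) : ‖w t x - w s z‖ ≤ K * (‖x - z‖ + √|t - s|) := by
  by_cases hpq : (t, x) = (s, z)
  · obtain ⟨rfl, rfl⟩ := Prod.mk.inj hpq
    simp
  have h1 : ‖w t x - w s z‖ₑ / ENNReal.ofReal (‖x - z‖ + √|t - s|) ≤ ENNReal.ofReal K := by
    refine le_trans ?_ h
    unfold parSeminorm
    refine le_trans ?_ (le_iSup₂ (t, x) hp)
    refine le_trans ?_ (le_iSup₂ (s, z) hq)
    exact le_iSup_of_le hpq le_rfl
  have hd : 0 < ‖x - z‖ + √|t - s| := by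
    by_cases hx : x = z
    · have ht : t ≠ s := fun ht => hpq (by rw [hx, ht])
      have : 0 < √|t - s| := Real.sqrt_pos.2 (abs_pos.2 (sub_ne_zero.2 ht))
      positivity
    · have : 0 < ‖x - z‖ := norm_pos_iff.2 (sub_ne_zero.2 hx)
      positivity
  rw [ENNReal.div_le_iff (by simpa using hd) ENNReal.ofReal_ne_top,
    ← ENNReal.ofReal_mul hK, ← ofReal_norm, ENNReal.ofReal_le_ofReal_iff (by positivity)] at h1
  exact h1

theorem parNorm_le_of_bounds {N : ℕ} {F : Type*} [NormedAddCommGroup F] {Q : Set (ℝ × Sp N)}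
    {w : ℝ → Sp N → F} {B L : ℝ} (hB : 0 ≤ B) (hL : 0 ≤ L)
    (h0 : ∀ t x, (t, x) ∈ Q → ‖w t x‖ ≤ B)
    (h1 : ∀ t x s z, (t, x) ∈ Q → (s, z) ∈ Q →
      ‖w t x - w s z‖ ≤ L * (‖x - z‖ + √|t - s|)) :
    parNorm Q w ≤ ENNReal.ofReal (B + L) := by
  rw [ENNReal.ofReal_add hB hL]
  refine add_le_add (iSup₂_le fun p hp => ?_) ?_
  · rw [← ofReal_norm]
    exact ENNReal.ofReal_le_ofReal (h0 p.1 p.2 hp)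
  · refine iSup₂_le fun p hp => iSup₂_le fun q hq => iSup_le fun _ => ?_
    refine ENNReal.div_le_of_le_mul ?_
    rw [← ENNReal.ofReal_mul hL, ← ofReal_norm]
    exact ENNReal.ofReal_le_ofReal (h1 _ _ _ _ hp hq)

/-- Bounds and Lipschitz bounds of the coefficients, together with the smallness of the time step
relative to them. -/
structure CoefficientBounds {N P : ℕ} {A : Type u} (D : Coefficients N P A) (Δt K : ℝ) :
    Prop where
  nonneg : 0 ≤ K
  norm_σ : ∀ α t x, ‖D.σ α t x‖ ≤ K
  norm_b : ∀ α t x, ‖D.b α t x‖ ≤ K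
  abs_c : ∀ α t x, |D.c α t x| ≤ K
  abs_f : ∀ α t x, |D.f α t x| ≤ K
  abs_g : ∀ x, |D.g x| ≤ K
  lip_c : ∀ α t s x z, |D.c α t x - D.c α s z| ≤ K * (‖x - z‖ + √|t - s|)
  lip_f : ∀ α t s x z, |D.f α t x - D.f α s z| ≤ K * (‖x - z‖ + √|t - s|)
  lip_g : ∀ x z, |D.g x - D.g z| ≤ K * ‖x - z‖
  lip_σb : ∀ α, ∃ a β : ℝ, 0 ≤ a ∧ a ≤ K ∧ 0 ≤ β ∧ β ≤ K ∧ 4 * Δt * (a ^ 2 + β ^ 2 + 1) ≤ 1 ∧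
    (∀ t s x z, ‖D.σ α t x - D.σ α s z‖ ≤ a * (‖x - z‖ + √|t - s|)) ∧
    (∀ t s x z, ‖D.b α t x - D.b α s z‖ ≤ β * (‖x - z‖ + √|t - s|))
  mul_c_le : ∀ α t x, Δt * D.c α t x ≤ 1 / 2

/-- The Lipschitz constants of `σ` and `b` are kept separate for each control: the restriction on
`k_1` ties the time step to these seminorms and not to the uniform bound `K`. The factor 4 in that
smallness is the 2 in the definition of `k_1` times the 2 in the restriction. -/
theorem AssumptionA1.coefficientBounds {N P : ℕ} {A : Type u} [Nonempty A]
    {D : Coefficients N P A}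
    {K Δt : ℝ} (h : AssumptionA1 D K) (hΔt : 0 < Δt)
    (h0 : 2 * kZero D * ENNReal.ofReal Δt ≤ 1) (h1 : 2 * kOne D * ENNReal.ofReal Δt ≤ 1) :
    CoefficientBounds D Δt (max K 0) := by
  set K' := max K 0 with hK'
  have hK0 : 0 ≤ K' := le_max_right _ _
  have hKK : ENNReal.ofReal K ≤ ENNReal.ofReal K' := ENNReal.ofReal_le_ofReal (le_max_left _ _)
  have hA := fun α => (h α).trans hKK
  have hg : parNorm ({(0 : ℝ)} ×ˢ univ) (fun _ x => D.g x) ≤ ENNReal.ofReal K' := by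
    obtain ⟨α⟩ := ‹Nonempty A›
    exact le_trans (le_trans le_self_add (le_trans le_self_add (le_trans le_self_add le_self_add)))
      (hA α)
  have hσ : ∀ α, parNorm univ (D.σ α) ≤ ENNReal.ofReal K' := fun α =>
    le_trans (le_trans le_add_self (le_trans le_self_add (le_trans le_self_add le_self_add))) (hA α)
  have hb : ∀ α, parNorm univ (D.b α) ≤ ENNReal.ofReal K' := fun α =>
    le_trans (le_trans le_add_self (le_trans le_self_add le_self_add)) (hA α)
  have hc : ∀ α, parNorm univ (D.c α) ≤ ENNReal.ofReal K' := fun α =>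
    le_trans (le_trans le_add_self le_self_add) (hA α)
  have hf : ∀ α, parNorm univ (D.f α) ≤ ENNReal.ofReal K' := fun α =>
    le_trans le_add_self (hA α)
  refine ⟨hK0, ?_, ?_, ?_, ?_, ?_, ?_, ?_, ?_, ?_, ?_⟩
  · exact fun α t x => norm_le_of_supNorm_le hK0 (le_self_add.trans (hσ α)) (mem_univ _)
  · exact fun α t x => norm_le_of_supNorm_le hK0 (le_self_add.trans (hb α)) (mem_univ _)
  · exact fun α t x => norm_le_of_supNorm_le hK0 (le_self_add.trans (hc α)) (mem_univ _)
  · exact fun α t x => norm_le_of_supNorm_le hK0 (le_self_add.trans (hf α)) (mem_univ _)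
  · exact fun x => norm_le_of_supNorm_le (w := fun _ x => D.g x) (t := 0) hK0
      (le_self_add.trans hg) (by simp)
  · exact fun α t s x z => norm_sub_le_of_parSeminorm_le hK0 (le_add_self.trans (hc α))
      (mem_univ _) (mem_univ _)
  · exact fun α t s x z => norm_sub_le_of_parSeminorm_le hK0 (le_add_self.trans (hf α))
      (mem_univ _) (mem_univ _)
  · intro x z
    have := norm_sub_le_of_parSeminorm_le (w := fun _ x => D.g x) (t := 0) (s := 0) (x := x)
      (z := z) hK0 (le_add_self.trans hg) (by simp) (by simp)
    simpa using this
  · intro α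
    have sσ : parSeminorm univ (D.σ α) ≤ ENNReal.ofReal K' := le_add_self.trans (hσ α)
    have sb : parSeminorm univ (D.b α) ≤ ENNReal.ofReal K' := le_add_self.trans (hb α)
    have fσ := ENNReal.ofReal_toReal (ne_top_of_le_ne_top ENNReal.ofReal_ne_top sσ)
    have fb := ENNReal.ofReal_toReal (ne_top_of_le_ne_top ENNReal.ofReal_ne_top sb)
    have pσ : parSeminorm univ (D.σ α) ≤ parNorm univ (D.σ α) := le_add_self
    have pb : parSeminorm univ (D.b α) ≤ parNorm univ (D.b α) := le_add_self
    refine ⟨(parSeminorm univ (D.σ α)).toReal, (parSeminorm univ (D.b α)).toReal,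
      ENNReal.toReal_nonneg, ENNReal.toReal_le_of_le_ofReal hK0 sσ, ENNReal.toReal_nonneg,
      ENNReal.toReal_le_of_le_ofReal hK0 sb, ?_, ?_, ?_⟩
    · set a := (parSeminorm univ (D.σ α)).toReal
      set β := (parSeminorm univ (D.b α)).toReal
      have ha : 0 ≤ a := ENNReal.toReal_nonneg
      have hβ : 0 ≤ β := ENNReal.toReal_nonneg
      rw [← ENNReal.ofReal_le_one]
      refine le_trans ?_ h1
      have : ENNReal.ofReal (4 * Δt * (a ^ 2 + β ^ 2 + 1))
          = 2 * (2 * (ENNReal.ofReal a ^ 2 + ENNReal.ofReal β ^ 2 + 1)) * ENNReal.ofReal Δt := by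
        rw [← ENNReal.ofReal_pow ha, ← ENNReal.ofReal_pow hβ, ← ENNReal.ofReal_one,
          ← ENNReal.ofReal_add (by positivity) (by positivity),
          ← ENNReal.ofReal_add (by positivity) (by positivity), ← ENNReal.ofReal_ofNat 2,
          ← ENNReal.ofReal_mul (by positivity), ← ENNReal.ofReal_mul (by positivity),
          ← ENNReal.ofReal_mul (by positivity)]
        congr 1
        ring
      rw [this, fσ, fb]
      gcongr
      unfold kOne
      gcongr
      refine le_trans ?_ (le_iSup _ α)
      gcongr
    · exact fun t s x z => norm_sub_le_of_parSeminorm_le ENNReal.toReal_nonneg fσ.ge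
        (mem_univ _) (mem_univ _)
    · exact fun t s x z => norm_sub_le_of_parSeminorm_le ENNReal.toReal_nonneg fb.ge
        (mem_univ _) (mem_univ _)
  · intro α t x
    have hm : ‖max (D.c α t x) 0‖ₑ ≤ kZero D := by
      unfold kZero
      refine le_trans ?_ (le_iSup _ α)
      exact le_iSup₂ (f := fun (p : ℝ × Sp N) (_ : p ∈ (univ : Set (ℝ × Sp N))) =>
        ‖max (D.c α p.1 p.2) 0‖ₑ) (t, x) (mem_univ _)
    have h2 : ENNReal.ofReal (2 * max (D.c α t x) 0 * Δt) ≤ 1 := by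
      refine le_trans ?_ h0
      rw [ENNReal.ofReal_mul (by positivity), ENNReal.ofReal_mul (by positivity),
        ENNReal.ofReal_ofNat]
      gcongr
      rwa [← ofReal_norm, Real.norm_of_nonneg (le_max_right _ _)] at hm
    rw [ENNReal.ofReal_le_one] at h2
    nlinarith [le_max_left (D.c α t x) 0]

/-! ### Schemes with translated coefficients -/

/-- The expression under the infimum of the scheme, with coefficients translated by `q.2`. -/
noncomputable def shiftHam {N P M : ℕ} {A : Type u} (D : Coefficients N P A) (Y : Stencil N M A)
    (k : ℝ) (q : A × ℝ × Sp N) (r : ℝ) (v : Sp N → ℝ) (x : Sp N) : ℝ :=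
  diffSum k v (fun i => x + Y.plus q.1 i (r + q.2.1) (x + q.2.2))
      (fun i => x + Y.minus q.1 i (r + q.2.1) (x + q.2.2)) x
    + D.c q.1 (r + q.2.1) (x + q.2.2) * v x + D.f q.1 (r + q.2.1) (x + q.2.2)

/-- The right-hand side of a scheme whose controls are pairs of an original control and a
translation of the coefficients. -/
noncomputable def shiftRHS {N P M : ℕ} {A : Type u} {J : Type*} (D : Coefficients N P A)
    (Y : Stencil N M A) (k Δt θ : ℝ) (π : J → A × ℝ × Sp N) (V : ℝ → Sp N → ℝ) (t : ℝ)
    (x : Sp N) : ℝ :=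
  ⨅ j : J, shiftHam D Y k (π j) (thetaTime θ Δt t) (thetaMean θ Δt V t) x

theorem schemeRHS_eq_shiftRHS {N P M : ℕ} {A : Type u} (D : Coefficients N P A)
    (Y : Stencil N M A) (k Δt θ : ℝ) :
    schemeRHS D Y k Δt θ = shiftRHS D Y k Δt θ (fun α : A => (α, 0, 0)) := by
  funext V t x
  simp [schemeRHS, shiftRHS, shiftHam, Lk, diffSum]

/-- The argument of `V` is shifted by `-e` and the base point by `e`; these cancel, and only the
coefficients remain translated. The shaken scheme is thus the original one with a larger control
set. -/
theorem shakenRHS_eq_shiftRHS {N P M : ℕ} {A : Type u} (D : Coefficients N P A)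
    (Y : Stencil N M A) (k Δt θ ε : ℝ) :
    shakenRHS D Y k Δt θ ε = shiftRHS D Y k Δt θ
      (fun q : A × Icc (0 : ℝ) (ε ^ 2) × Metric.closedBall (0 : Sp N) ε =>
        (q.1, (q.2.1 : ℝ) - Δt - ε ^ 2, (q.2.2 : Sp N))) := by
  funext V t x
  unfold shakenRHS shiftRHS shiftHam
  refine iInf_congr fun q => ?_
  have e1 : thetaTime θ Δt t - Δt - ε ^ 2 + q.2.1
      = thetaTime θ Δt t + ((q.2.1 : ℝ) - Δt - ε ^ 2) := by ring
  have e2 : ∀ y : Sp N, x + (q.2.2 : Sp N) + y - (q.2.2 : Sp N) = x + y := fun y => by abel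
  simp only [e1, Lk, diffSum, e2, add_sub_cancel_right]

/-- Assumptions on the data of the scheme. -/
structure SchemeAssumptions {N P M : ℕ} {A : Type u} (D : Coefficients N P A)
    (Y : Stencil N M A) (k Δt θ K KY : ℝ) : Prop where
  k_pos : 0 < k
  k_lt_one : k < 1
  Δt_pos : 0 < Δt
  θ_nonneg : 0 ≤ θ
  θ_le_one : θ ≤ 1
  bounds : CoefficientBounds D Δt K
  moments : AssumptionY1 D Y k KY
  coupling : AssumptionY2 D Y k
  cfl : CFL D M k Δt θ

/-- Makes the real infimum a genuine one. The bound degenerates as `k → 0`, which is harmless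
because it is used only qualitatively. -/
theorem SchemeAssumptions.bddBelow {N P M : ℕ} {A : Type u} {J : Type*}
    {D : Coefficients N P A} {Y : Stencil N M A} {k Δt θ K KY : ℝ}
    (h : SchemeAssumptions D Y k Δt θ K KY) (π : J → A × ℝ × Sp N) (r : ℝ) {v : Sp N → ℝ}
    {B : ℝ} (hv : ∀ x, |v x| ≤ B) (x : Sp N) :
    BddBelow (range fun j => shiftHam D Y k (π j) r v x) := by
  have hk := h.k_pos
  refine ⟨-(M / k ^ 2 * (B - -v x)) - K * B - K, ?_⟩
  rintro _ ⟨j, rfl⟩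
  have h1 := diffSum_le_of_le (M := M) hk (v := fun x => -v x) (m := B)
    (fun i => x + Y.plus (π j).1 i (r + (π j).2.1) (x + (π j).2.2))
    (fun i => x + Y.minus (π j).1 i (r + (π j).2.1) (x + (π j).2.2)) x
    (fun y => (neg_le_abs _).trans (hv y))
  have h2 := diffSum_const_mul_add k (-1) 0 v
    (fun i => x + Y.plus (π j).1 i (r + (π j).2.1) (x + (π j).2.2))
    (fun i => x + Y.minus (π j).1 i (r + (π j).2.1) (x + (π j).2.2)) x
  simp only [neg_mul, one_mul, add_zero] at h2
  rw [h2] at h1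
  have h3 : |D.c (π j).1 (r + (π j).2.1) (x + (π j).2.2) * v x| ≤ K * B := by
    rw [abs_mul]
    exact mul_le_mul (h.bounds.abs_c _ _ _) (hv x) (abs_nonneg _) h.bounds.nonneg
  have h4 := h.bounds.abs_f (π j).1 (r + (π j).2.1) (x + (π j).2.2)
  have h5 := neg_abs_le (D.c (π j).1 (r + (π j).2.1) (x + (π j).2.2) * v x)
  have h6 := neg_abs_le (D.f (π j).1 (r + (π j).2.1) (x + (π j).2.2))
  simp only [shiftHam]
  linarith

theorem abs_thetaMean_le {N : ℕ} {θ Δt B : ℝ} (hθ0 : 0 ≤ θ) (hθ1 : θ ≤ 1) {V : ℝ → Sp N → ℝ}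
    {t : ℝ} {x : Sp N} (h0 : |V (t - Δt) x| ≤ B) (h1 : |V t x| ≤ B) :
    |thetaMean θ Δt V t x| ≤ B := by
  unfold thetaMean
  have h2 : 0 ≤ 1 - θ := by linarith
  calc |(1 - θ) * V (t - Δt) x + θ * V t x| ≤ (1 - θ) * |V (t - Δt) x| + θ * |V t x| := by
        refine (abs_add_le _ _).trans (le_of_eq ?_)
        rw [abs_mul, abs_mul, abs_of_nonneg h2, abs_of_nonneg hθ0]
    _ ≤ (1 - θ) * B + θ * B := by gcongr
    _ = B := by ring

section Solutions

variable {N P M : ℕ} {A : Type u} {J : Type*} {D : Coefficients N P A} {Y : Stencil N M A}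
  {k Δt θ K KY S : ℝ} {π : J → A × ℝ × Sp N} {V : ℝ → Sp N → ℝ}

theorem IsSolution.sub_le (h : SchemeAssumptions D Y k Δt θ K KY)
    (hV : IsSolution (shiftRHS D Y k Δt θ π) D.g Δt S V) {t : ℝ} (ht : t ∈ Icc Δt S) (x : Sp N)
    (j : J) : V t x - V (t - Δt) x
      ≤ Δt * shiftHam D Y k (π j) (thetaTime θ Δt t) (thetaMean θ Δt V t) x := by
  have hΔt := h.Δt_pos
  obtain ⟨B, hB⟩ := hV.bounded
  have e := hV.equation t ht x
  rw [backDiff, div_eq_iff hΔt.ne', mul_comm] at e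
  rw [e]
  refine mul_le_mul_of_nonneg_left (ciInf_le ?_ j) hΔt.le
  exact h.bddBelow π _ (B := B) (fun y => abs_thetaMean_le h.θ_nonneg h.θ_le_one
    (hB _ ⟨by linarith [ht.1], by linarith [ht.2]⟩ y) (hB _ ⟨by linarith [ht.1], ht.2⟩ y)) x

/-- The infimum need not be attained; the loss `η` is the one tolerated by
`nonpos_of_monotone_step`. -/
theorem IsSolution.exists_le_sub [Nonempty J] (h : SchemeAssumptions D Y k Δt θ K KY)
    (hV : IsSolution (shiftRHS D Y k Δt θ π) D.g Δt S V) {t : ℝ} (ht : t ∈ Icc Δt S) (x : Sp N)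
    {η : ℝ} (hη : 0 < η) : ∃ j, Δt * shiftHam D Y k (π j) (thetaTime θ Δt t)
      (thetaMean θ Δt V t) x - η ≤ V t x - V (t - Δt) x := by
  have hΔt := h.Δt_pos
  have e := hV.equation t ht x
  rw [backDiff, div_eq_iff hΔt.ne', mul_comm] at e
  rw [e]
  obtain ⟨j, hj⟩ := exists_lt_of_ciInf_lt (lt_add_of_pos_right
    (shiftRHS D Y k Δt θ π V t x) (div_pos hη hΔt))
  refine ⟨j, ?_⟩
  have := mul_le_mul_of_nonneg_left hj.le hΔt.le
  rw [mul_add, mul_div_cancel₀ _ hΔt.ne'] at this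
  linarith

end Solutions

/-! ### Action of the scheme on quadratic functions -/

theorem norm_add_sq_second_difference {N : ℕ} (d u v : Sp N) :
    ‖d + u‖ ^ 2 - 2 * ‖d‖ ^ 2 + ‖d + v‖ ^ 2
      = 2 * inner ℝ d (u + v) + (‖u‖ ^ 2 + ‖v‖ ^ 2) := by
  rw [norm_add_sq_real, norm_add_sq_real, inner_add_right]
  ring

theorem trace_outer {N : ℕ} (v w : Sp N) : (outer v w).trace = inner ℝ v w := by
  simp [Matrix.trace, outer, PiLp.inner_apply, mul_comm]

theorem trace_mul_transpose_eq_norm_sq {N P : ℕ} (B : Matrix (Fin N) (Fin P) ℝ) :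
    (B * B.transpose).trace = ‖B‖ ^ 2 := by
  rw [Matrix.frobenius_norm_def, ← Real.sqrt_eq_rpow, Real.sq_sqrt (by positivity)]
  simp [Matrix.trace, Matrix.mul_apply, pow_two]

section Quadratic

variable {N P M : ℕ} {A : Type u} {D : Coefficients N P A} {Y : Stencil N M A} {k KY : ℝ}

/-- The one-sided condition holds for both orders of the two points, so it is an equality. -/
theorem AssumptionY2.sum_mean (hY : AssumptionY2 D Y k) (α : A) (t s : ℝ) (x z : Sp N) :
    ∑ i, ((Y.plus α i t x - Y.plus α i s z) + (Y.minus α i t x - Y.minus α i s z))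
      = (2 * k ^ 2) • (D.b α t x - D.b α s z) := by
  ext a
  have h1 := hY.mean α t s x z a
  have h2 := hY.mean α s t z x a
  have e : (∑ i, ((Y.plus α i t x - Y.plus α i s z) + (Y.minus α i t x - Y.minus α i s z))) a
      = ∑ i, ((Y.plus α i t x a + Y.minus α i t x a)
        - (Y.plus α i s z a + Y.minus α i s z a)) := by
    rw [WithLp.ofLp_sum, Finset.sum_apply]
    exact Finset.sum_congr rfl fun i _ => by simp; ring
  have e2 : ∑ i, ((Y.plus α i s z a + Y.minus α i s z a)
      - (Y.plus α i t x a + Y.minus α i t x a)) = -∑ i, ((Y.plus α i t x a + Y.minus α i t x a)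
        - (Y.plus α i s z a + Y.minus α i s z a)) := by
    rw [← Finset.sum_neg_distrib]
    exact Finset.sum_congr rfl fun i _ => by ring
  rw [e2] at h2
  rw [e]
  simp only [PiLp.smul_apply, PiLp.sub_apply, smul_eq_mul]
  linarith

/-- Trace of the semidefinite inequality. Nothing more is needed, because the test function `‖x - z‖
^ 2` has the same weight in every direction. -/
theorem AssumptionY2.sum_norm_sq_le (hY : AssumptionY2 D Y k) (α : A) (t s : ℝ) (x z : Sp N) :
    ∑ i, (‖Y.plus α i t x - Y.plus α i s z‖ ^ 2 + ‖Y.minus α i t x - Y.minus α i s z‖ ^ 2)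
      ≤ 2 * k ^ 2 * ‖D.σ α t x - D.σ α s z‖ ^ 2
        + 2 * k ^ 4 * ‖D.b α t x - D.b α s z‖ ^ 2 := by
  have h := (hY.covariance α t s x z).trace_nonneg
  simp only [Matrix.trace_sub, Matrix.trace_add, Matrix.trace_smul, Matrix.trace_sum,
    trace_outer, trace_mul_transpose_eq_norm_sq, smul_eq_mul, real_inner_self_eq_norm_sq] at h
  rw [sub_nonneg] at h
  refine le_trans (le_of_eq (Finset.sum_congr rfl fun i _ => ?_)) h
  rw [norm_sub_sq_real, norm_sub_sq_real, real_inner_comm (Y.plus α i t x) (Y.plus α i s z),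
    real_inner_comm (Y.minus α i t x) (Y.minus α i s z)]
  ring

theorem AssumptionY2.diffSum_norm_sq_le (hY : AssumptionY2 D Y k) (hk : 0 < k) (α : A)
    (t s : ℝ) (x z p q : Sp N) :
    diffSum k (fun w : Sp N × Sp N => ‖w.1 - w.2‖ ^ 2)
      (fun i => (p + Y.plus α i t x, q + Y.plus α i s z))
      (fun i => (p + Y.minus α i t x, q + Y.minus α i s z)) (p, q)
      ≤ 2 * inner ℝ (p - q) (D.b α t x - D.b α s z) + ‖D.σ α t x - D.σ α s z‖ ^ 2
        + k ^ 2 * ‖D.b α t x - D.b α s z‖ ^ 2 := by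
  unfold diffSum
  rw [← Finset.sum_div, div_le_iff₀ (by positivity)]
  have e : ∀ i, ‖p + Y.plus α i t x - (q + Y.plus α i s z)‖ ^ 2 - 2 * ‖p - q‖ ^ 2
      + ‖p + Y.minus α i t x - (q + Y.minus α i s z)‖ ^ 2
      = 2 * inner ℝ (p - q) ((Y.plus α i t x - Y.plus α i s z)
          + (Y.minus α i t x - Y.minus α i s z))
        + (‖Y.plus α i t x - Y.plus α i s z‖ ^ 2 + ‖Y.minus α i t x - Y.minus α i s z‖ ^ 2) := by
    intro i
    rw [← norm_add_sq_second_difference, add_sub_add_comm, add_sub_add_comm]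
  simp only [e]
  rw [Finset.sum_add_distrib, ← Finset.mul_sum, ← inner_sum, hY.sum_mean, inner_smul_right]
  have := hY.sum_norm_sq_le α t s x z
  nlinarith

/-- Only the moments of order one and two enter, with the errors `k ^ 4` absorbed by `k < 1`.
Young's inequality is arranged to give `‖p - q‖ ^ 2` the coefficient 1, used as `C₁` in
`IsSolution.abs_sub_le_grid`. -/
theorem AssumptionY1.diffSum_norm_sq_le (hY : AssumptionY1 D Y k KY) (hk : 0 < k) (hk1 : k < 1)
    {K : ℝ} (α : A) (t : ℝ) (x p q : Sp N) (hσ : ‖D.σ α t x‖ ≤ K) (hb : ‖D.b α t x‖ ≤ K) :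
    diffSum k (fun w : Sp N => ‖w - q‖ ^ 2) (fun i => p + Y.plus α i t x)
      (fun i => p + Y.minus α i t x) p
      ≤ ‖p - q‖ ^ 2 + (N * (K + |KY|) ^ 2 + K ^ 2 + N * |KY|) := by
  unfold diffSum
  have hk2 : 0 < k ^ 2 := by positivity
  have hk21 : k ^ 2 < 1 := by nlinarith
  have hKk : KY * k ^ 4 ≤ k ^ 2 * |KY| := by
    have h1 : KY * k ^ 4 ≤ |KY| * k ^ 4 :=
      mul_le_mul_of_nonneg_right (le_abs_self _) (by positivity)
    have h2 : |KY| * k ^ 2 * k ^ 2 ≤ |KY| * k ^ 2 * 1 :=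
      mul_le_mul_of_nonneg_left hk21.le (by positivity)
    nlinarith
  rw [← Finset.sum_div, div_le_iff₀ (by positivity)]
  have e : ∀ i, ‖p + Y.plus α i t x - q‖ ^ 2 - 2 * ‖p - q‖ ^ 2 + ‖p + Y.minus α i t x - q‖ ^ 2
      = 2 * inner ℝ (p - q) (Y.plus α i t x + Y.minus α i t x)
        + (‖Y.plus α i t x‖ ^ 2 + ‖Y.minus α i t x‖ ^ 2) := by
    intro i
    rw [← norm_add_sq_second_difference, add_sub_right_comm, add_sub_right_comm]
  simp only [e]
  rw [Finset.sum_add_distrib, ← Finset.mul_sum, ← inner_sum]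
  have hK : 0 ≤ K := (norm_nonneg _).trans hb
  have h1 : 2 * inner ℝ (p - q) (∑ i, (Y.plus α i t x + Y.minus α i t x))
      ≤ 2 * k ^ 2 * (‖p - q‖ ^ 2 + N * (K + |KY|) ^ 2) := by
    have hc : ∀ a : Fin N, 2 * ((p - q) a * (∑ i, (Y.plus α i t x + Y.minus α i t x)) a)
        ≤ 2 * k ^ 2 * ((p - q) a ^ 2 + (K + |KY|) ^ 2) := by
      intro a
      have h2 := hY.first α t x a
      have h3 : (∑ i, (Y.plus α i t x + Y.minus α i t x)) a
          = ∑ i, (Y.plus α i t x a + Y.minus α i t x a) := by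
        rw [WithLp.ofLp_sum, Finset.sum_apply]; rfl
      rw [← h3] at h2
      set Z := (∑ i, (Y.plus α i t x + Y.minus α i t x)) a
      have h4 : |D.b α t x a| ≤ K := (PiLp.norm_apply_le (D.b α t x) a).trans hb
      have h5 : |Z| ≤ 2 * k ^ 2 * (K + |KY|) := by
        have h6 : |Z| ≤ |Z - 2 * k ^ 2 * D.b α t x a| + |2 * k ^ 2 * D.b α t x a| := by
          have := abs_add_le (Z - 2 * k ^ 2 * D.b α t x a) (2 * k ^ 2 * D.b α t x a)
          rwa [sub_add_cancel] at this
        rw [abs_mul, abs_of_nonneg (by positivity : (0:ℝ) ≤ 2 * k ^ 2)] at h6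
        have h7 : 2 * k ^ 2 * |D.b α t x a| ≤ 2 * k ^ 2 * K :=
          mul_le_mul_of_nonneg_left h4 (by positivity)
        have h8 : 0 ≤ k ^ 2 * |KY| := by positivity
        nlinarith
      have h9 : (p - q) a * Z ≤ |(p - q) a| * (2 * k ^ 2 * (K + |KY|)) :=
        (le_abs_self _).trans (by rw [abs_mul]; exact mul_le_mul_of_nonneg_left h5 (abs_nonneg _))
      have h10 := mul_nonneg hk2.le (sq_nonneg (|(p - q) a| - (K + |KY|)))
      have h11 := sq_abs ((p - q) a)
      nlinarith
    generalize ∑ i, (Y.plus α i t x + Y.minus α i t x) = W at hc ⊢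
    have h12 := Finset.sum_le_sum fun a (_ : a ∈ (Finset.univ : Finset (Fin N))) => hc a
    rw [← Finset.mul_sum, ← Finset.mul_sum, Finset.sum_add_distrib] at h12
    simp only [Finset.sum_const, Finset.card_univ, Fintype.card_fin, nsmul_eq_mul] at h12
    rw [PiLp.inner_apply, EuclideanSpace.real_norm_sq_eq]
    simpa [mul_comm] using h12
  have h2 : ∑ i, (‖Y.plus α i t x‖ ^ 2 + ‖Y.minus α i t x‖ ^ 2)
      ≤ 2 * k ^ 2 * (K ^ 2 + N * |KY|) := by
    have hc : ∀ a : Fin N, ∑ i, (Y.plus α i t x a * Y.plus α i t x a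
        + Y.minus α i t x a * Y.minus α i t x a)
        ≤ 2 * k ^ 2 * (D.σ α t x * (D.σ α t x).transpose) a a + k ^ 2 * |KY| := fun a => by
      have := (abs_le.1 (hY.second α t x a a)).2
      linarith
    have h3 := Finset.sum_le_sum fun a (_ : a ∈ (Finset.univ : Finset (Fin N))) => hc a
    rw [Finset.sum_add_distrib, ← Finset.mul_sum, Finset.sum_comm] at h3
    have h4 := trace_mul_transpose_eq_norm_sq (D.σ α t x)
    simp only [Matrix.trace, Matrix.diag_apply] at h4
    rw [h4] at h3
    simp only [Finset.sum_const, Finset.card_univ, Fintype.card_fin, nsmul_eq_mul] at h3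
    have h5 : 2 * k ^ 2 * ‖D.σ α t x‖ ^ 2 ≤ 2 * k ^ 2 * K ^ 2 := by gcongr
    have h6 : 0 ≤ N * (k ^ 2 * |KY|) := by positivity
    simp only [EuclideanSpace.real_norm_sq_eq, ← Finset.sum_add_distrib]
    simp only [← pow_two] at h3
    linarith
  linarith

/-- Young's inequality for the terms of the coupling estimate; `σd` and `bd` are the increments of
`σ` and `b` between points at parabolic distance `ℓ`. -/
theorem coupling_constant_bound {a β d ℓ h i σd bd k : ℝ} (hd : 0 ≤ d) (hβ : 0 ≤ β)
    (hℓ0 : 0 ≤ ℓ) (hℓ : ℓ ≤ d + h) (hk : 0 < k) (hk1 : k < 1)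
    (hσ0 : 0 ≤ σd) (hb0 : 0 ≤ bd) (hσ : σd ≤ a * ℓ) (hb : bd ≤ β * ℓ) (hi : i ≤ d * bd) :
    2 * i + σd ^ 2 + k ^ 2 * bd ^ 2
      ≤ 9 / 5 * (a ^ 2 + β ^ 2 + 1) * d ^ 2 + 41 * (a ^ 2 + β ^ 2) * h ^ 2 := by
  -- The weights put almost all of the loss on `h`. In total `β ^ 2 * d ^ 2` receives 21/20 + 3/4
  -- and `d ^ 2` receives 1/20 + 7/4, both equal to 9/5; with `4 * Δt * (a ^ 2 + β ^ 2 + 1) ≤ 1`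
  -- this becomes 9/20.
  have hℓ2 : ℓ ^ 2 ≤ 21 / 20 * d ^ 2 + 21 * h ^ 2 := by
    have h1 : ℓ ^ 2 ≤ (d + h) ^ 2 := pow_le_pow_left₀ hℓ0 hℓ 2
    nlinarith [sq_nonneg (d - 20 * h)]
  have h1 : σd ^ 2 ≤ a ^ 2 * ℓ ^ 2 := by rw [← mul_pow]; exact pow_le_pow_left₀ hσ0 hσ 2
  have h2 : bd ^ 2 ≤ β ^ 2 * ℓ ^ 2 := by rw [← mul_pow]; exact pow_le_pow_left₀ hb0 hb 2
  have h3 : k ^ 2 * bd ^ 2 ≤ bd ^ 2 := by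
    have : k ^ 2 ≤ 1 := by nlinarith
    nlinarith [sq_nonneg bd]
  have h4 : d * bd ≤ d * (β * (d + h)) :=
    mul_le_mul_of_nonneg_left (hb.trans (mul_le_mul_of_nonneg_left hℓ hβ)) hd
  have h5 : a ^ 2 * ℓ ^ 2 ≤ a ^ 2 * (21 / 20 * d ^ 2 + 21 * h ^ 2) :=
    mul_le_mul_of_nonneg_left hℓ2 (sq_nonneg a)
  have h6 : β ^ 2 * ℓ ^ 2 ≤ β ^ 2 * (21 / 20 * d ^ 2 + 21 * h ^ 2) :=
    mul_le_mul_of_nonneg_left hℓ2 (sq_nonneg β)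
  have h7 : 2 * (d * (β * h)) ≤ 1 / 20 * d ^ 2 + 20 * (β ^ 2 * h ^ 2) := by
    nlinarith [sq_nonneg (d - 20 * (β * h))]
  have h8 : 2 * β * d ^ 2 ≤ (3 / 4 * β ^ 2 + 7 / 4) * d ^ 2 :=
    mul_le_mul_of_nonneg_right (by nlinarith [sq_nonneg (β - 4 / 3)]) (sq_nonneg d)
  have h9 : 0 ≤ a ^ 2 * d ^ 2 := by positivity
  have h10 : 0 ≤ a ^ 2 * h ^ 2 := by positivity
  nlinarith

end Quadratic

/-! ### Growth estimates along a time grid -/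

theorem thetaMean_grid {N : ℕ} (θ Δt a : ℝ) (V : ℝ → Sp N → ℝ) (m : ℕ) :
    thetaMean θ Δt V (a + (m + 1 : ℕ) * Δt)
      = fun x => (1 - θ) * V (a + m * Δt) x + θ * V (a + (m + 1 : ℕ) * Δt) x := by
  funext x
  have : a + (m + 1 : ℕ) * Δt - Δt = a + m * Δt := by push_cast; ring
  rw [thetaMean, this]

theorem geometric_barrier_le {B r Δt S ψ : ℝ} {n : ℕ} (hB : 0 ≤ B) (hr : 0 ≤ r) (hΔt : 0 ≤ Δt)
    (hn : n * Δt ≤ S) (hψ : 0 ≤ ψ) :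
    ((B + 1) * (1 + r * Δt) ^ n - 1) * ψ ≤ (B + 1) * Real.exp (r * S) * ψ := by
  refine mul_le_mul_of_nonneg_right ?_ hψ
  have h1 : (1 + r * Δt) ^ n ≤ Real.exp (r * S) := by
    calc (1 + r * Δt) ^ n ≤ (Real.exp (r * Δt)) ^ n := by
          refine pow_le_pow_left₀ (by positivity) ?_ n
          linarith [Real.add_one_le_exp (r * Δt)]
      _ = Real.exp (r * (n * Δt)) := by rw [← Real.exp_nat_mul]; ring_nf
      _ ≤ Real.exp (r * S) := Real.exp_le_exp.2 (mul_le_mul_of_nonneg_left hn hr)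
  have := mul_le_mul_of_nonneg_left h1 (show 0 ≤ B + 1 by linarith)
  linarith

theorem diffSum_pair_sub {N M : ℕ} (k : ℝ) (v₁ v₂ : Sp N → ℝ) (P₁ Q₁ P₂ Q₂ : Fin M → Sp N)
    (p : Sp N × Sp N) :
    diffSum k (fun w : Sp N × Sp N => v₁ w.1 - v₂ w.2) (fun i => (P₁ i, P₂ i))
      (fun i => (Q₁ i, Q₂ i)) p = diffSum k v₁ P₁ Q₁ p.1 - diffSum k v₂ P₂ Q₂ p.2 := by
  unfold diffSum
  rw [← Finset.sum_sub_distrib]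
  exact Finset.sum_congr rfl fun i _ => by ring

theorem SchemeAssumptions.mul_max_c_le {N P M : ℕ} {A : Type u} {D : Coefficients N P A}
    {Y : Stencil N M A} {k Δt θ K KY : ℝ} (h : SchemeAssumptions D Y k Δt θ K KY) (α : A) (t : ℝ)
    (x : Sp N) : Δt * max (D.c α t x) 0 ≤ 1 / 2 ∧ max (D.c α t x) 0 ≤ K := by
  refine ⟨?_, max_le ((le_abs_self _).trans (h.bounds.abs_c α t x)) h.bounds.nonneg⟩
  rw [mul_max_of_nonneg _ _ h.Δt_pos.le, mul_zero]
  exact max_le (h.bounds.mul_c_le α t x) (by norm_num)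

section Growth

variable {N P M : ℕ} {A : Type u} {D : Coefficients N P A} {Y : Stencil N M A}
  {k Δt θ K KY : ℝ}

/-- Subtracting the constant `v₀` from a solution creates the source `c * v₀ + f`. For `ς = 1` the
linear inequality holds with any control and for `ς = -1` with a nearly optimal one, so a nearly
optimal control serves both signs. -/
theorem IsSolution.growth_single {J : Type*} [Nonempty J] {S' S : ℝ} {π : J → A × ℝ × Sp N}
    {V : ℝ → Sp N → ℝ} (h : SchemeAssumptions D Y k Δt θ K KY)
    (hV : IsSolution (shiftRHS D Y k Δt θ π) D.g Δt S' V) {a : ℝ} (ha : 0 ≤ a) {n : ℕ}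
    (hn : a + n * Δt ≤ S') (hnS : n * Δt ≤ S) {ς v₀ C₁ κ e B : ℝ} (hς : ς = 1 ∨ ς = -1) (hC₁ : 0 ≤ C₁)
    (hC₁Δt : Δt * C₁ ≤ 9 / 20) (hκ : 0 ≤ κ) (he : 0 ≤ e) (hB : 1 ≤ B) {ψ : Sp N → ℝ}
    (hψ : ∀ x, 0 ≤ ψ x)
    (hquad : ∀ α t x p, diffSum k ψ (fun i => p + Y.plus α i t x)
      (fun i => p + Y.minus α i t x) p ≤ C₁ * ψ p + e / 4)
    (hF : ∀ x, K * |v₀| + K ≤ κ * ψ x + e / 4) (h0 : ∀ x, ς * (V a x - v₀) ≤ B * ψ x) (x : Sp N) :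
    ς * (V (a + n * Δt) x - v₀)
      ≤ (B + 1) * Real.exp (20 * (C₁ + K + κ) * S) * (ψ x + n * Δt * e) := by
  have hΔt := h.Δt_pos
  have hK := h.bounds.nonneg
  have hς1 : |ς| = 1 := by rcases hς with rfl | rfl <;> simp
  have hgrid : ∀ m ≤ n, a + m * Δt ≤ S' := fun m hm => by
    have : (m : ℝ) * Δt ≤ n * Δt := mul_le_mul_of_nonneg_right (by exact_mod_cast hm) hΔt.le
    linarith
  refine (monotone_step_growth (M := M) (Cb := K) (μ := C₁ + K) (κ := κ) (e := e)
    (w := fun m x => ς * (V (a + m * Δt) x - v₀)) h.k_pos hΔt h.θ_nonneg h.θ_le_one hκ he hB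
    (by positivity) hψ ?_ (by simpa using h0) ?_ x).trans
    (geometric_barrier_le (by linarith) (by positivity) hΔt.le hnS
      (by have := hψ x; positivity))
  · intro m hm
    obtain ⟨b, hb⟩ := hV.bounded
    refine ⟨b + |v₀|, ?_⟩
    rintro _ ⟨y, rfl⟩
    have h1 := hb (a + m * Δt) ⟨by positivity, hgrid m hm⟩ y
    calc ς * (V (a + m * Δt) y - v₀) ≤ |ς * (V (a + m * Δt) y - v₀)| := le_abs_self _
      _ ≤ |V (a + m * Δt) y| + |v₀| := by rw [abs_mul, hς1, one_mul]; exact abs_sub _ _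
      _ ≤ b + |v₀| := by linarith
  · intro m hm p η hη
    have ht : a + (m + 1 : ℕ) * Δt ∈ Icc Δt S' := by
      refine ⟨?_, hgrid _ hm⟩
      push_cast
      have : 0 ≤ (m : ℝ) * Δt := by positivity
      linarith
    obtain ⟨j, hj⟩ := hV.exists_le_sub h ht p hη
    have hj' := hV.sub_le h ht p j
    have et : a + (m + 1 : ℕ) * Δt - Δt = a + m * Δt := by push_cast; ring
    rw [et, thetaMean_grid, shiftHam] at hj hj'
    set α := (π j).1
    set r := thetaTime θ Δt (a + (m + 1 : ℕ) * Δt) + (π j).2.1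
    set y := p + (π j).2.2
    obtain ⟨hm1, hm2⟩ := h.mul_max_c_le α r y
    refine ⟨fun i => p + Y.plus α i r y, fun i => p + Y.minus α i r y, D.c α r y, C₁,
      ς * (D.c α r y * v₀ + D.f α r y), (h.cfl α r y).1, h.bounds.mul_c_le α r y,
      h.bounds.abs_c α r y, hC₁, by linarith, by linarith, ?_, hquad α r y p, ?_⟩
    · refine le_trans (le_trans (le_abs_self _) ?_) (hF p)
      rw [abs_mul, hς1, one_mul]
      refine (abs_add_le _ _).trans (add_le_add ?_ (h.bounds.abs_f α r y))
      rw [abs_mul]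
      exact mul_le_mul_of_nonneg_right (h.bounds.abs_c α r y) (abs_nonneg _)
    · have e1 : (fun q => (1 - θ) * (ς * (V (a + m * Δt) q - v₀))
          + θ * (ς * (V (a + (m + 1 : ℕ) * Δt) q - v₀)))
          = fun q => ς * ((1 - θ) * V (a + m * Δt) q + θ * V (a + (m + 1 : ℕ) * Δt) q)
            + (-(ς * v₀)) := by funext q; ring
      rw [e1, diffSum_const_mul_add]
      rcases hς with rfl | rfl <;> linarith

/-- Doubling of variables for two solutions whose coefficients differ by translations of
parabolic size at most `h`. -/
theorem IsSolution.growth_pair {J₁ J₂ : Type*} [Nonempty J₁] [Nonempty J₂] {S₁ S₂ S a₁ a₂ : ℝ}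
    {π₁ : J₁ → A × ℝ × Sp N} {π₂ : J₂ → A × ℝ × Sp N} {V₁ V₂ : ℝ → Sp N → ℝ}
    (h : SchemeAssumptions D Y k Δt θ K KY)
    (hV₁ : IsSolution (shiftRHS D Y k Δt θ π₁) D.g Δt S₁ V₁)
    (hV₂ : IsSolution (shiftRHS D Y k Δt θ π₂) D.g Δt S₂ V₂) {B₂ : ℝ}
    (hB₂ : ∀ t ∈ Icc 0 S₂, ∀ x, |V₂ t x| ≤ B₂) (ha₁ : 0 ≤ a₁) (ha₂ : 0 ≤ a₂) {n : ℕ}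
    (hn₁ : a₁ + n * Δt ≤ S₁) (hn₂ : a₂ + n * Δt ≤ S₂) (hnS : n * Δt ≤ S) {δ l B : ℝ} (hδ : 0 ≤ δ)
    (hl : 0 < l) (hlδ : l * δ ≤ 1) (hB : 1 ≤ B)
    (hπ : ∀ j₂, ∃ j₁, (π₁ j₁).1 = (π₂ j₂).1 ∧ ‖(π₁ j₁).2.2 - (π₂ j₂).2.2‖
      + √|(a₁ + (π₁ j₁).2.1) - (a₂ + (π₂ j₂).2.1)| ≤ δ)
    (h0 : ∀ x z, V₁ a₁ x - V₂ a₂ z ≤ B * (l * ‖x - z‖ ^ 2 + 1 / l)) (x z : Sp N) :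
    V₁ (a₁ + n * Δt) x - V₂ (a₂ + n * Δt) z
      ≤ (B + 1) * (Real.exp (20 * (9 / 5 * (2 * K ^ 2 + 1) + K + 2 * K * (B₂ + 1)) * S)
        * (1 + 328 * K ^ 2 * S)) * (l * ‖x - z‖ ^ 2 + 1 / l) := by
  have hΔt := h.Δt_pos
  have hK := h.bounds.nonneg
  have hgrid : ∀ m ≤ n, a₁ + m * Δt ≤ S₁ ∧ a₂ + m * Δt ≤ S₂ := fun m hm => by
    have : (m : ℝ) * Δt ≤ n * Δt := mul_le_mul_of_nonneg_right (by exact_mod_cast hm) hΔt.le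
    exact ⟨by linarith, by linarith⟩
  have hB₂0 : 0 ≤ B₂ := (abs_nonneg _).trans (hB₂ (a₂ + n * Δt) ⟨by positivity, hn₂⟩ z)
  -- Four times the part of the coupling estimate that comes from the translation, as `41 * (s ^ 2 +
  -- β ^ 2) ≤ 82 * K ^ 2`. Since `l * δ ≤ 1` and `δ ≤ ψ`, it is at most `328 * K ^ 2 * ψ`.
  set e := 4 * (l * (82 * K ^ 2 * δ ^ 2)) with he
  have he0 : 0 ≤ e := by positivity
  set ψ : Sp N × Sp N → ℝ := fun p => l * ‖p.1 - p.2‖ ^ 2 + 1 / l with hψ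
  have hψ0 : ∀ p, 0 ≤ ψ p := fun p => by simp only [hψ]; positivity
  have hδl : δ ≤ 1 / l := by rw [le_div_iff₀ hl]; linarith
  have hδψ : ∀ p, δ ≤ ψ p := fun p => by
    have : 0 ≤ l * ‖p.1 - p.2‖ ^ 2 := by positivity
    simp only [hψ]; linarith
  have hdψ : ∀ p, ‖p.1 - p.2‖ ≤ ψ p := fun p => by
    simp only [hψ]
    have h1 : l * ‖p.1 - p.2‖ ^ 2 + 1 / l - 2 * ‖p.1 - p.2‖
        = (l * ‖p.1 - p.2‖ - 1) ^ 2 / l := by field_simp; ring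
    have h2 : 0 ≤ (l * ‖p.1 - p.2‖ - 1) ^ 2 / l := by positivity
    linarith [norm_nonneg (p.1 - p.2)]
  set r := 20 * (9 / 5 * (2 * K ^ 2 + 1) + K + 2 * K * (B₂ + 1)) with hr
  have key := monotone_step_growth (M := M) (Cb := K) (μ := 9 / 5 * (2 * K ^ 2 + 1) + K)
    (κ := 2 * K * (B₂ + 1)) (e := e) (ψ := ψ) (n := n)
    (w := fun m (p : Sp N × Sp N) => V₁ (a₁ + m * Δt) p.1 - V₂ (a₂ + m * Δt) p.2)
    h.k_pos hΔt h.θ_nonneg h.θ_le_one (by positivity) he0 hB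
    (by positivity) hψ0 ?_
    (fun p => by simpa only [Nat.cast_zero, zero_mul, add_zero] using h0 p.1 p.2) ?_ (x, z)
  · refine key.trans ((geometric_barrier_le (S := S) (by linarith) (by positivity) hΔt.le hnS
      (by have := hψ0 (x, z); positivity)).trans ?_)
    have h1 : n * Δt * e ≤ 328 * K ^ 2 * S * ψ (x, z) := by
      have h2 : e ≤ 328 * K ^ 2 * ψ (x, z) := by
        have h3 : l * δ * δ ≤ 1 * ψ (x, z) := mul_le_mul hlδ (hδψ _) hδ zero_le_one
        have h4 := mul_le_mul_of_nonneg_left h3 (show 0 ≤ 328 * K ^ 2 by positivity)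
        rw [he]; linarith
      calc n * Δt * e ≤ S * (328 * K ^ 2 * ψ (x, z)) :=
            mul_le_mul hnS h2 he0 (le_trans (by positivity) hnS)
        _ = _ := by ring
    have h2 : ψ (x, z) + n * Δt * e ≤ (1 + 328 * K ^ 2 * S) * ψ (x, z) := by linarith
    calc (B + 1) * Real.exp (r * S) * (ψ (x, z) + n * Δt * e)
        ≤ (B + 1) * Real.exp (r * S) * ((1 + 328 * K ^ 2 * S) * ψ (x, z)) :=
          mul_le_mul_of_nonneg_left h2 (by positivity)
      _ = _ := by ring
  · intro m hm
    obtain ⟨b, hb⟩ := hV₁.bounded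
    refine ⟨b + B₂, ?_⟩
    rintro _ ⟨p, rfl⟩
    have h1 := hb (a₁ + m * Δt) ⟨by positivity, (hgrid m hm).1⟩ p.1
    have h2 := hB₂ (a₂ + m * Δt) ⟨by positivity, (hgrid m hm).2⟩ p.2
    have h3 := le_abs_self (V₁ (a₁ + m * Δt) p.1)
    have h4 := neg_abs_le (V₂ (a₂ + m * Δt) p.2)
    simp only
    linarith
  · rintro m hm ⟨p, q⟩ η hη
    have ht : ∀ a : ℝ, 0 ≤ a → Δt ≤ a + (m + 1 : ℕ) * Δt := fun a ha => by
      push_cast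
      have : 0 ≤ (m : ℝ) * Δt := by positivity
      linarith
    -- A nearly optimal choice for `V₂` is imitated by `V₁` with the same original control, so that
    -- (Y2) applies to the pair of displacements.
    obtain ⟨j₂, hj₂⟩ := hV₂.exists_le_sub h ⟨ht a₂ ha₂, (hgrid _ hm).2⟩ q hη
    obtain ⟨j₁, hα, hj⟩ := hπ j₂
    have hj₁ := hV₁.sub_le h ⟨ht a₁ ha₁, (hgrid _ hm).1⟩ p j₁
    have et : ∀ a : ℝ, a + (m + 1 : ℕ) * Δt - Δt = a + m * Δt := fun a => by push_cast; ring
    rw [et, thetaMean_grid, shiftHam] at hj₁ hj₂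
    rw [hα] at hj₁
    set α := (π₂ j₂).1
    have er : |(thetaTime θ Δt (a₁ + (m + 1 : ℕ) * Δt) + (π₁ j₁).2.1)
        - (thetaTime θ Δt (a₂ + (m + 1 : ℕ) * Δt) + (π₂ j₂).2.1)|
        = |(a₁ + (π₁ j₁).2.1) - (a₂ + (π₂ j₂).2.1)| := by
      unfold thetaTime; congr 1; ring
    have hdist : ‖(p + (π₁ j₁).2.2) - (q + (π₂ j₂).2.2)‖
        + √|(thetaTime θ Δt (a₁ + (m + 1 : ℕ) * Δt) + (π₁ j₁).2.1)
        - (thetaTime θ Δt (a₂ + (m + 1 : ℕ) * Δt) + (π₂ j₂).2.1)| ≤ ‖p - q‖ + δ := by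
      rw [er, add_sub_add_comm]
      have := norm_add_le (p - q) ((π₁ j₁).2.2 - (π₂ j₂).2.2)
      linarith
    set r₁ := thetaTime θ Δt (a₁ + (m + 1 : ℕ) * Δt) + (π₁ j₁).2.1
    set r₂ := thetaTime θ Δt (a₂ + (m + 1 : ℕ) * Δt) + (π₂ j₂).2.1
    set y₁ := p + (π₁ j₁).2.2
    set y₂ := q + (π₂ j₂).2.2
    obtain ⟨hm1, hm2⟩ := h.mul_max_c_le α r₁ y₁
    obtain ⟨s, β, hs0, hsK, hβ0, hβK, hsmall, hσlip, hblip⟩ := h.bounds.lip_σb α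
    have hs2 : s ^ 2 ≤ K ^ 2 := pow_le_pow_left₀ hs0 hsK 2
    have hβ2 : β ^ 2 ≤ K ^ 2 := pow_le_pow_left₀ hβ0 hβK 2
    -- The zeroth-order coefficient of the difference is the one at the first point; the mismatch of
    -- the two, times the mean of `V₂`, goes into the source. This is why a bound for `V₂` is needed
    -- beforehand.
    refine ⟨fun i => (p + Y.plus α i r₁ y₁, q + Y.plus α i r₂ y₂),
      fun i => (p + Y.minus α i r₁ y₁, q + Y.minus α i r₂ y₂), D.c α r₁ y₁,
      9 / 5 * (s ^ 2 + β ^ 2 + 1),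
      (D.c α r₁ y₁ - D.c α r₂ y₂) * ((1 - θ) * V₂ (a₂ + m * Δt) q
        + θ * V₂ (a₂ + (m + 1 : ℕ) * Δt) q) + (D.f α r₁ y₁ - D.f α r₂ y₂),
      (h.cfl α r₁ y₁).1, h.bounds.mul_c_le α r₁ y₁, h.bounds.abs_c α r₁ y₁, by positivity,
      by linarith, by linarith, ?_, ?_, ?_⟩
    · have hv : |(1 - θ) * V₂ (a₂ + m * Δt) q + θ * V₂ (a₂ + (m + 1 : ℕ) * Δt) q| ≤ B₂ := by
        have := abs_thetaMean_le (V := V₂) (x := q) (t := a₂ + (m + 1 : ℕ) * Δt) (Δt := Δt)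
          (B := B₂) h.θ_nonneg h.θ_le_one
          (by rw [et]; exact hB₂ _ ⟨by positivity, (hgrid m hm.le).2⟩ q)
          (hB₂ _ ⟨by positivity, (hgrid _ hm).2⟩ q)
        rwa [thetaMean_grid] at this
      have hc := (h.bounds.lip_c α r₁ r₂ y₁ y₂).trans (mul_le_mul_of_nonneg_left hdist hK)
      have hf := (h.bounds.lip_f α r₁ r₂ y₁ y₂).trans (mul_le_mul_of_nonneg_left hdist hK)
      have hcv := (le_abs_self _).trans ((abs_mul (D.c α r₁ y₁ - D.c α r₂ y₂) ((1 - θ)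
        * V₂ (a₂ + m * Δt) q + θ * V₂ (a₂ + (m + 1 : ℕ) * Δt) q)).le.trans
        (mul_le_mul hc hv (abs_nonneg _) (by positivity)))
      have hf' := (le_abs_self _).trans hf
      have h1 : K * (‖p - q‖ + δ) * (B₂ + 1) ≤ K * (ψ (p, q) + ψ (p, q)) * (B₂ + 1) := by
        have := hdψ (p, q)
        have := hδψ (p, q)
        gcongr
      linarith
    · have h1 := h.coupling.diffSum_norm_sq_le h.k_pos α r₁ r₂ y₁ y₂ p q
      have h2 := coupling_constant_bound (a := s) (norm_nonneg (p - q)) hβ0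
        (by positivity) hdist h.k_pos h.k_lt_one (norm_nonneg _) (norm_nonneg _)
        (hσlip r₁ r₂ y₁ y₂) (hblip r₁ r₂ y₁ y₂) (real_inner_le_norm _ _)
      rw [diffSum_const_mul_add]
      have h3 := mul_le_mul_of_nonneg_left (h1.trans h2) hl.le
      have h4 : l * (41 * (s ^ 2 + β ^ 2) * δ ^ 2) ≤ l * (82 * K ^ 2 * δ ^ 2) := by
        refine mul_le_mul_of_nonneg_left (mul_le_mul_of_nonneg_right ?_ (sq_nonneg _)) hl.le
        linarith
      have h5 : 0 ≤ 9 / 5 * (s ^ 2 + β ^ 2 + 1) * (1 / l) := by positivity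
      simp only [hψ, he]
      linarith
    · have e1 : (fun w : Sp N × Sp N =>
          (1 - θ) * (V₁ (a₁ + m * Δt) w.1 - V₂ (a₂ + m * Δt) w.2)
          + θ * (V₁ (a₁ + (m + 1 : ℕ) * Δt) w.1 - V₂ (a₂ + (m + 1 : ℕ) * Δt) w.2))
          = fun w => (fun x => (1 - θ) * V₁ (a₁ + m * Δt) x
              + θ * V₁ (a₁ + (m + 1 : ℕ) * Δt) x) w.1
            - (fun x => (1 - θ) * V₂ (a₂ + m * Δt) x
              + θ * V₂ (a₂ + (m + 1 : ℕ) * Δt) x) w.2 := by funext w; ring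
      have e2 := diffSum_pair_sub k
        (fun x => (1 - θ) * V₁ (a₁ + m * Δt) x + θ * V₁ (a₁ + (m + 1 : ℕ) * Δt) x)
        (fun x => (1 - θ) * V₂ (a₂ + m * Δt) x + θ * V₂ (a₂ + (m + 1 : ℕ) * Δt) x)
        (fun i => p + Y.plus α i r₁ y₁) (fun i => p + Y.minus α i r₁ y₁)
        (fun i => q + Y.plus α i r₂ y₂) (fun i => q + Y.minus α i r₂ y₂) (p, q)
      rw [e1]
      refine le_trans ?_ (add_le_add_left (mul_le_mul_of_nonneg_left
        (add_le_add_left (add_le_add_left e2.ge _) _) hΔt.le) _)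
      simp only
      linarith

end Growth

/-! ### Regularity of solutions of the scheme -/

theorem exists_eq_add_mul {Δt t : ℝ} (hΔt : 0 < Δt) (ht : 0 ≤ t) :
    ∃ (n : ℕ) (a : ℝ), 0 ≤ a ∧ a < Δt ∧ t = a + n * Δt := by
  refine ⟨⌊t / Δt⌋₊, t - ⌊t / Δt⌋₊ * Δt, ?_, ?_, by ring⟩
  · have := Nat.floor_le (div_nonneg ht hΔt.le)
    rw [le_div_iff₀ hΔt] at this
    linarith
  · have := Nat.lt_floor_add_one (t / Δt)
    rw [div_lt_iff₀ hΔt] at this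
    linarith

theorem le_parabola {l d : ℝ} (hl : 0 < l) (hd : 0 ≤ d) : d ≤ l * d ^ 2 + 1 / l := by
  have h1 : l * d ^ 2 + 1 / l - 2 * d = (l * d - 1) ^ 2 / l := by field_simp; ring
  have h2 : 0 ≤ (l * d - 1) ^ 2 / l := by positivity
  linarith

/-- A bound for the solutions of the scheme on a time interval of length at most `S`. -/
noncomputable def supConst (K S : ℝ) : ℝ :=
  ((K + 2) * Real.exp (20 * (2 * K) * S) + 1) * Real.exp (20 * (2 * K) * S)

/-- The growth factor in the doubling of variables. -/
noncomputable def pairFactor (K S : ℝ) : ℝ :=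
  Real.exp (20 * (9 / 5 * (2 * K ^ 2 + 1) + K + 2 * K * (supConst K S + 1)) * S)
    * (1 + 328 * K ^ 2 * S)

/-- The constant in the comparison of two solutions with the same initial datum. -/
noncomputable def pairConst (K S : ℝ) : ℝ := ((K + 2) * pairFactor K S + 1) * pairFactor K S

/-- The constant in the time regularity estimate for time differences that are multiples of the
step size. -/
noncomputable def gridTimeConst (N : ℕ) (K KY S : ℝ) : ℝ :=
  (2 * pairConst K S + 2) * Real.exp (20 * (1 + K) * S)
    * (1 + 4 * (N * (K + |KY|) ^ 2 + K ^ 2 + N * |KY|) + 4 * (K * (supConst K S + 1)) * √S)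

/-- The constant in the time regularity estimate within one time step. -/
noncomputable def stepTimeConst (N : ℕ) (K KY S : ℝ) : ℝ :=
  (gridTimeConst N K KY S + 2 * pairConst K S + 2) * pairFactor K S

/-- The constant in the time regularity estimate. -/
noncomputable def timeConst (N : ℕ) (K KY S : ℝ) : ℝ :=
  2 * stepTimeConst N K KY S + gridTimeConst N K KY S

theorem one_le_exp_mul {a S : ℝ} (ha : 0 ≤ a) (hS : 0 ≤ S) : 1 ≤ Real.exp (a * S) :=
  Real.one_le_exp (mul_nonneg ha hS)

theorem supConst_nonneg {K S : ℝ} (hK : 0 ≤ K) : 0 ≤ supConst K S := by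
  unfold supConst; positivity

theorem one_le_pairFactor {K S : ℝ} (hK : 0 ≤ K) (hS : 0 ≤ S) : 1 ≤ pairFactor K S := by
  have h0 := supConst_nonneg (S := S) hK
  have h1 : 1 ≤ Real.exp (20 * (9 / 5 * (2 * K ^ 2 + 1) + K + 2 * K * (supConst K S + 1)) * S) :=
    one_le_exp_mul (by positivity) hS
  have h2 : 1 ≤ 1 + 328 * K ^ 2 * S := le_add_of_nonneg_right (by positivity)
  exact one_le_mul_of_one_le_of_one_le h1 h2

theorem one_le_pairConst {K S : ℝ} (hK : 0 ≤ K) (hS : 0 ≤ S) : 1 ≤ pairConst K S := by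
  have := one_le_pairFactor hK hS
  refine one_le_mul_of_one_le_of_one_le ?_ this
  nlinarith

theorem gridTimeConst_nonneg {N : ℕ} {K KY S : ℝ} (hK : 0 ≤ K) (hS : 0 ≤ S) :
    0 ≤ gridTimeConst N K KY S := by
  have := one_le_pairConst hK hS
  have := supConst_nonneg (S := S) hK
  unfold gridTimeConst
  positivity

theorem stepTimeConst_nonneg {N : ℕ} {K KY S : ℝ} (hK : 0 ≤ K) (hS : 0 ≤ S) :
    0 ≤ stepTimeConst N K KY S := by
  have := one_le_pairConst hK hS
  have := gridTimeConst_nonneg (N := N) (KY := KY) hK hS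
  have := one_le_pairFactor hK hS
  unfold stepTimeConst
  positivity

section Regularity

variable {N P M : ℕ} {A : Type u} {D : Coefficients N P A} {Y : Stencil N M A}
  {k Δt θ K KY S' S : ℝ} {J : Type*} [Nonempty J] {π : J → A × ℝ × Sp N} {V : ℝ → Sp N → ℝ}

theorem IsSolution.apply_zero {H : (ℝ → Sp N → ℝ) → ℝ → Sp N → ℝ} {g : Sp N → ℝ}
    (hV : IsSolution H g Δt S' V) (hΔt : 0 < Δt) (x : Sp N) : V 0 x = g x := by
  rw [hV.initial 0 ⟨le_rfl, hΔt.le⟩ x]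
  simp

/-- An upper bound at times `0` and `Δt` that is affine in the solution holds in between. -/
theorem IsSolution.initial_convex {H₁ H₂ : (ℝ → Sp N → ℝ) → ℝ → Sp N → ℝ} {g : Sp N → ℝ}
    {S₁ S₂ : ℝ} {V₁ V₂ : ℝ → Sp N → ℝ}
    (hV₁ : IsSolution H₁ g Δt S₁ V₁) (hV₂ : IsSolution H₂ g Δt S₂ V₂) (hΔt : 0 < Δt)
    {B C : ℝ} {x z : Sp N} (h0 : B * g x - C * g z ≤ 1)
    (h1 : B * V₁ Δt x - C * V₂ Δt z ≤ 1) {a : ℝ}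
    (ha : a ∈ Icc 0 Δt) : B * V₁ a x - C * V₂ a z ≤ 1 := by
  rw [hV₁.initial a ha, hV₂.initial a ha]
  have h2 : 0 ≤ a / Δt := div_nonneg ha.1 hΔt.le
  have h3 : a / Δt ≤ 1 := (div_le_one hΔt).2 ha.2
  generalize a / Δt = τ at *
  have h4 := mul_le_mul_of_nonneg_left h0 (sub_nonneg.2 h3)
  have h5 := mul_le_mul_of_nonneg_left h1 h2
  linarith

/-- Comparison with the barrier 1 is run twice: over the first step from `g`, and then, after
interpolation on `[0, Δt]`, along the grid through `t`. Hence the nested form of the constant. -/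
theorem IsSolution.abs_le_supConst (h : SchemeAssumptions D Y k Δt θ K KY)
    (hV : IsSolution (shiftRHS D Y k Δt θ π) D.g Δt S' V) (hΔtS' : Δt ≤ S') (hS : S' ≤ S) {t : ℝ}
    (ht : t ∈ Icc 0 S') (x : Sp N) : |V t x| ≤ supConst K S := by
  have hΔt := h.Δt_pos
  have hK := h.bounds.nonneg
  have hS0 : 0 ≤ S := by linarith
  set G := Real.exp (20 * (2 * K) * S) with hG
  have hG1 : 1 ≤ G := one_le_exp_mul (by positivity) hS0
  have grow : ∀ {a : ℝ} {n : ℕ}, 0 ≤ a → a + n * Δt ≤ S' → ∀ {ς B : ℝ}, ς = 1 ∨ ς = -1 → 1 ≤ B →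
      (∀ x, ς * V a x ≤ B) → ∀ x, ς * V (a + n * Δt) x ≤ (B + 1) * G := by
    intro a n ha hn ς B hς hB h0 x
    have := hV.growth_single (S := S) h ha hn (by linarith) (v₀ := 0) (C₁ := 0) (κ := K)
      (e := 0) (ψ := fun _ => 1) hς le_rfl (by norm_num) hK le_rfl hB (fun _ => zero_le_one)
      (fun α t x p => by simp [diffSum]; norm_num) (by simp) (by simpa using h0) x
    simp only [sub_zero, mul_zero, add_zero, mul_one, zero_add] at this
    rwa [← two_mul] at this
  have hb : ∀ ς : ℝ, ς = 1 ∨ ς = -1 → ς * V t x ≤ supConst K S := by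
    intro ς hς
    have habs : ∀ y : ℝ, ς * y ≤ |y| := fun y => by
      rcases hς with rfl | rfl
      · simpa using le_abs_self y
      · simpa using neg_le_abs y
    have hg : ∀ x, ς * D.g x ≤ K + 1 := fun x =>
      (habs _).trans ((h.bounds.abs_g x).trans (by linarith))
    have h1 : ∀ x, ς * V Δt x ≤ (K + 2) * G := fun x => by
      have := grow (n := 1) le_rfl (by simpa using hΔtS') hς (B := K + 1) (by linarith)
        (fun x => by rw [hV.apply_zero hΔt]; exact hg x) x
      simp only [Nat.cast_one, one_mul, zero_add] at this
      linarith
    have hB1 : 1 ≤ (K + 2) * G := by nlinarith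
    have h2 : ∀ a ∈ Icc 0 Δt, ∀ x, ς * V a x ≤ (K + 2) * G := fun a ha x => by
      have hpos : 0 < (K + 2) * G := by linarith
      have := hV.initial_convex hV hΔt (B := ς / ((K + 2) * G)) (C := 0) (x := x) (z := x)
        (by rw [zero_mul, sub_zero, div_mul_eq_mul_div, div_le_one hpos]
            nlinarith [hg x])
        (by rw [zero_mul, sub_zero, div_mul_eq_mul_div, div_le_one hpos]; exact h1 x) ha
      rwa [zero_mul, sub_zero, div_mul_eq_mul_div, div_le_one hpos] at this
    obtain ⟨n, a, ha0, ha1, rfl⟩ := exists_eq_add_mul hΔt ht.1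
    exact grow ha0 ht.2 hς hB1 (h2 a ⟨ha0, ha1.le⟩) x
  exact abs_le'.2 ⟨by simpa using hb 1 (Or.inl rfl), by simpa using hb (-1) (Or.inr rfl)⟩

/-- Comparison of two solutions with the same initial datum and translated coefficients. -/
theorem IsSolution.sub_le_pairConst {J₂ : Type*} [Nonempty J₂] {S₁ S₂ : ℝ}
    {π₂ : J₂ → A × ℝ × Sp N}
    {V₂ : ℝ → Sp N → ℝ} (h : SchemeAssumptions D Y k Δt θ K KY)
    (hV₁ : IsSolution (shiftRHS D Y k Δt θ π) D.g Δt S₁ V)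
    (hV₂ : IsSolution (shiftRHS D Y k Δt θ π₂) D.g Δt S₂ V₂) (hΔtS₁ : Δt ≤ S₁) (hΔtS₂ : Δt ≤ S₂)
    (hS₂ : S₂ ≤ S) {δ l : ℝ} (hδ : 0 ≤ δ) (hl : 0 < l) (hlδ : l * δ ≤ 1)
    (hπ : ∀ j₂, ∃ j₁, (π j₁).1 = (π₂ j₂).1 ∧ ‖(π j₁).2.2 - (π₂ j₂).2.2‖
      + √|(π j₁).2.1 - (π₂ j₂).2.1| ≤ δ) {t : ℝ} (ht0 : 0 ≤ t) (ht₁ : t ≤ S₁) (ht₂ : t ≤ S₂)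
    (x z : Sp N) : V t x - V₂ t z ≤ pairConst K S * (l * ‖x - z‖ ^ 2 + 1 / l) := by
  have hΔt := h.Δt_pos
  have hK := h.bounds.nonneg
  have hS0 : 0 ≤ S := by linarith
  have hG1 := one_le_pairFactor hK hS0
  have grow : ∀ {a : ℝ} {n : ℕ}, 0 ≤ a → a + n * Δt ≤ S₁ → a + n * Δt ≤ S₂ → ∀ {B : ℝ}, 1 ≤ B →
      (∀ x z, V a x - V₂ a z ≤ B * (l * ‖x - z‖ ^ 2 + 1 / l)) → ∀ x z,
      V (a + n * Δt) x - V₂ (a + n * Δt) z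
        ≤ (B + 1) * pairFactor K S * (l * ‖x - z‖ ^ 2 + 1 / l) := by
    intro a n ha hn₁ hn₂ B hB h0 x z
    exact hV₁.growth_pair h hV₂ (fun t ht x => hV₂.abs_le_supConst h hΔtS₂ hS₂ ht x)
      ha ha hn₁ hn₂ (by linarith) hδ hl hlδ hB
      (fun j₂ => by
        obtain ⟨j₁, h1, h2⟩ := hπ j₂
        exact ⟨j₁, h1, by rwa [add_sub_add_left_eq_sub]⟩) h0 x z
  have hψ : ∀ x z : Sp N, 0 < l * ‖x - z‖ ^ 2 + 1 / l := fun x z => by positivity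
  have hg : ∀ x z, D.g x - D.g z ≤ (K + 1) * (l * ‖x - z‖ ^ 2 + 1 / l) := fun x z => by
    have h1 := (le_abs_self _).trans (h.bounds.lip_g x z)
    have h2 := mul_le_mul_of_nonneg_left (le_parabola hl (norm_nonneg (x - z))) hK
    have := (hψ x z).le
    linarith
  have h1 : ∀ x z, V Δt x - V₂ Δt z
      ≤ (K + 2) * pairFactor K S * (l * ‖x - z‖ ^ 2 + 1 / l) := fun x z => by
    have := grow (n := 1) le_rfl (by simpa using hΔtS₁) (by simpa using hΔtS₂) (B := K + 1)
      (by linarith)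
      (fun x z => by rw [hV₁.apply_zero hΔt, hV₂.apply_zero hΔt]; exact hg x z) x z
    simp only [Nat.cast_one, one_mul, zero_add] at this
    linarith
  have hB1 : K + 2 ≤ (K + 2) * pairFactor K S := le_mul_of_one_le_right (by linarith) hG1
  have h2 : ∀ a ∈ Icc 0 Δt, ∀ x z, V a x - V₂ a z
      ≤ (K + 2) * pairFactor K S * (l * ‖x - z‖ ^ 2 + 1 / l) := fun a ha x z => by
    have hψ' := hψ x z
    have hpos : 0 < (K + 2) * pairFactor K S * (l * ‖x - z‖ ^ 2 + 1 / l) :=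
      mul_pos (by linarith) hψ'
    -- Division by the bound brings the estimate to the normalised form required by
    -- `IsSolution.initial_convex`.
    have e : ∀ u v : ℝ, 1 / ((K + 2) * pairFactor K S * (l * ‖x - z‖ ^ 2 + 1 / l)) * u
        - 1 / ((K + 2) * pairFactor K S * (l * ‖x - z‖ ^ 2 + 1 / l)) * v ≤ 1
        ↔ u - v ≤ (K + 2) * pairFactor K S * (l * ‖x - z‖ ^ 2 + 1 / l) := fun u v => by
      rw [← mul_sub, div_mul_eq_mul_div, one_mul, div_le_one hpos]
    rw [← e]
    refine hV₁.initial_convex hV₂ hΔt ?_ ?_ ha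
    · rw [e]
      refine (hg x z).trans (mul_le_mul_of_nonneg_right ?_ hψ'.le)
      linarith
    · rw [e]; exact h1 x z
  obtain ⟨n, a, ha0, ha1, rfl⟩ := exists_eq_add_mul hΔt ht0
  exact grow ha0 ht₁ ht₂ (by linarith) (h2 a ⟨ha0, ha1.le⟩) x z

/-- The solution is compared with itself without translation; the parabola is optimal at `l = 1 / ‖x
- z‖`, where it equals `2 * ‖x - z‖`. -/
theorem IsSolution.lipschitz (h : SchemeAssumptions D Y k Δt θ K KY)
    (hV : IsSolution (shiftRHS D Y k Δt θ π) D.g Δt S' V) (hΔtS' : Δt ≤ S') (hS : S' ≤ S) {t : ℝ}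
    (ht : t ∈ Icc 0 S') (x z : Sp N) : |V t x - V t z| ≤ 2 * pairConst K S * ‖x - z‖ := by
  have key : ∀ x z, V t x - V t z ≤ 2 * pairConst K S * ‖x - z‖ := fun x z => by
    by_cases hxz : x = z
    · simp [hxz]
    have hd : 0 < ‖x - z‖ := norm_pos_iff.2 (sub_ne_zero.2 hxz)
    have := hV.sub_le_pairConst h hV hΔtS' hΔtS' hS (δ := 0) (l := 1 / ‖x - z‖) le_rfl
      (by positivity) (by simp) (fun j => ⟨j, rfl, by simp⟩) ht.1 ht.2 ht.2 x z
    have e : 1 / ‖x - z‖ * ‖x - z‖ ^ 2 + 1 / (1 / ‖x - z‖) = 2 * ‖x - z‖ := by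
      field_simp; ring
    rw [e] at this
    linarith
  refine abs_le'.2 ⟨key x z, ?_⟩
  rw [neg_sub, norm_sub_rev]
  exact key z x

/-- On the diagonal the barrier is `1 / l`, and the largest `l` allowed is `1 / δ`. -/
theorem IsSolution.sub_le_of_translation {J₂ : Type*} [Nonempty J₂] {S₁ S₂ : ℝ}
    {π₂ : J₂ → A × ℝ × Sp N}
    {V₂ : ℝ → Sp N → ℝ} (h : SchemeAssumptions D Y k Δt θ K KY)
    (hV₁ : IsSolution (shiftRHS D Y k Δt θ π) D.g Δt S₁ V)
    (hV₂ : IsSolution (shiftRHS D Y k Δt θ π₂) D.g Δt S₂ V₂) (hΔtS₁ : Δt ≤ S₁) (hΔtS₂ : Δt ≤ S₂)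
    (hS₂ : S₂ ≤ S) {δ : ℝ} (hδ : 0 < δ)
    (hπ : ∀ j₂, ∃ j₁, (π j₁).1 = (π₂ j₂).1 ∧ ‖(π j₁).2.2 - (π₂ j₂).2.2‖
      + √|(π j₁).2.1 - (π₂ j₂).2.1| ≤ δ) {t : ℝ} (ht0 : 0 ≤ t) (ht₁ : t ≤ S₁) (ht₂ : t ≤ S₂)
    (x : Sp N) : V t x - V₂ t x ≤ pairConst K S * δ := by
  have := hV₁.sub_le_pairConst h hV₂ hΔtS₁ hΔtS₂ hS₂ (l := 1 / δ) hδ.le (by positivity)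
    (by rw [one_div_mul_cancel hδ.ne']) hπ ht0 ht₁ ht₂ x x
  simpa using this

/-- With `q = √(n * Δt)`, the parabola of curvature `1 / q` and height `q` around `x` dominates `V a
- V a x` up to a constant, by the Lipschitz bound. During the time `q ^ 2` its second differences,
of order `1 / q`, raise it by order `q` only. -/
theorem IsSolution.abs_sub_le_grid (h : SchemeAssumptions D Y k Δt θ K KY)
    (hV : IsSolution (shiftRHS D Y k Δt θ π) D.g Δt S' V) (hΔtS' : Δt ≤ S') (hS : S' ≤ S) {a : ℝ}
    (ha : 0 ≤ a) {n : ℕ} (hn : a + n * Δt ≤ S') (x : Sp N) :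
    |V (a + n * Δt) x - V a x| ≤ gridTimeConst N K KY S * √(n * Δt) := by
  have hΔt := h.Δt_pos
  have hK := h.bounds.nonneg
  have hnS : n * Δt ≤ S := by linarith
  have hS0 : 0 ≤ S := by linarith
  have hpc := one_le_pairConst hK hS0
  have hsup0 := supConst_nonneg (S := S) hK
  rcases Nat.eq_zero_or_pos n with rfl | hnpos
  · simp
  have hnΔ : 0 < n * Δt := by positivity
  set q := √(n * Δt) with hq
  have hqpos : 0 < q := Real.sqrt_pos.2 hnΔ
  have hq2 : n * Δt = q ^ 2 := (Real.sq_sqrt hnΔ.le).symm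
  set C₆ := N * (K + |KY|) ^ 2 + K ^ 2 + N * |KY| with hC₆
  have hC₆0 : 0 ≤ C₆ := by positivity
  have ha' : a ∈ Icc 0 S' := ⟨ha, by linarith⟩
  -- With `C₁ = 1` the growth estimate requires `Δt ≤ 9 / 20`; the summand 1 in `k_1` already gives
  -- more.
  have hΔt4 : Δt ≤ 1 / 4 := by
    obtain ⟨j⟩ := ‹Nonempty J›
    obtain ⟨s, β, -, -, -, -, hsm, -⟩ := h.bounds.lip_σb (π j).1
    nlinarith [mul_nonneg hΔt.le (sq_nonneg s), mul_nonneg hΔt.le (sq_nonneg β)]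
  have key : ∀ ς : ℝ, ς = 1 ∨ ς = -1 →
      ς * (V (a + n * Δt) x - V a x) ≤ gridTimeConst N K KY S * q := by
    intro ς hς
    have hς1 : |ς| = 1 := by rcases hς with rfl | rfl <;> simp
    have hψ0 : ∀ y : Sp N, 0 ≤ 1 / q * ‖y - x‖ ^ 2 + 1 / (1 / q) := fun y => by positivity
    have := hV.growth_single (S := S) h ha hn hnS (v₀ := V a x) (C₁ := 1) (κ := 0)
      (e := 4 * (1 / q * C₆ + K * (supConst K S + 1))) (B := 2 * pairConst K S + 1)
      (ψ := fun y => 1 / q * ‖y - x‖ ^ 2 + 1 / (1 / q)) hς zero_le_one (by linarith) le_rfl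
      (by positivity) (by linarith) hψ0 ?_ ?_ ?_ x
    · refine this.trans ?_
      simp only [sub_self, norm_zero, one_div_one_div]
      rw [add_zero, hq2, gridTimeConst, mul_assoc]
      have e : (1 / q * 0 ^ 2 + q + q ^ 2 * (4 * (1 / q * C₆ + K * (supConst K S + 1))))
          = (1 + 4 * C₆ + 4 * (K * (supConst K S + 1)) * q) * q := by field_simp; ring
      rw [e]
      have hqS : q ≤ √S := Real.sqrt_le_sqrt hnS
      rw [show 2 * pairConst K S + 1 + 1 = 2 * pairConst K S + 2 by ring]
      calc _ ≤ (2 * pairConst K S + 2) * (Real.exp (20 * (1 + K) * S)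
            * ((1 + 4 * C₆ + 4 * (K * (supConst K S + 1)) * √S) * q)) := by gcongr
        _ = _ := by ring
    · intro α t y p
      rw [diffSum_const_mul_add]
      have h1 := h.moments.diffSum_norm_sq_le h.k_pos h.k_lt_one α t y p x
        (h.bounds.norm_σ α t y) (h.bounds.norm_b α t y)
      have h2 := mul_le_mul_of_nonneg_left h1 (show 0 ≤ 1 / q by positivity)
      have h3 : 0 ≤ K * (supConst K S + 1) := by positivity
      have h4 : 0 ≤ 1 / (1 / q) := by positivity
      linarith
    · intro y
      have h1 := hV.abs_le_supConst h hΔtS' hS ha' x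
      have h2 := mul_le_mul_of_nonneg_left h1 hK
      have h3 : 0 ≤ 1 / q * C₆ := by positivity
      linarith
    · intro y
      have h1 := hV.lipschitz h hΔtS' hS ha' y x
      have h2 : ς * (V a y - V a x) ≤ |V a y - V a x| := by
        rw [← one_mul |_|, ← hς1, ← abs_mul]; exact le_abs_self _
      have h3 := mul_le_mul_of_nonneg_left (le_parabola (show 0 < 1 / q by positivity)
        (norm_nonneg (y - x))) (show 0 ≤ 2 * pairConst K S by linarith)
      have h4 := hψ0 y
      linarith
  exact abs_le'.2 ⟨by simpa using key 1 (Or.inl rfl), by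
    have := key (-1) (Or.inr rfl)
    linarith⟩

/-- In the first cell the linear interpolation turns the grid increment of order `√Δt` into `|a - b|
/ √Δt ≤ √|a - b|`. Later cells follow by comparing `V` with its own time translate, whose
coefficients are displaced by the parabolic distance `√|a - b|`. -/
theorem IsSolution.abs_sub_le_step (h : SchemeAssumptions D Y k Δt θ K KY)
    (hV : IsSolution (shiftRHS D Y k Δt θ π) D.g Δt S' V) (hΔtS' : Δt ≤ S') (hS : S' ≤ S)
    {a b : ℝ} (ha : a ∈ Icc 0 Δt) (hb : b ∈ Icc 0 Δt) {n : ℕ} (hna : a + n * Δt ≤ S')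
    (hnb : b + n * Δt ≤ S') (x : Sp N) :
    |V (a + n * Δt) x - V (b + n * Δt) x| ≤ stepTimeConst N K KY S * √|a - b| := by
  have hΔt := h.Δt_pos
  have hK := h.bounds.nonneg
  have hS0 : 0 ≤ S := by linarith
  have hpc := one_le_pairConst hK hS0
  have hgt := gridTimeConst_nonneg (N := N) (KY := KY) hK hS0
  have hG := one_le_pairFactor hK hS0
  by_cases hab : a = b
  · simp [hab]
  set δ := √|a - b| with hδ
  have hδpos : 0 < δ := Real.sqrt_pos.2 (abs_pos.2 (sub_ne_zero.2 hab))
  have hinit : ∀ y, |V a y - V b y| ≤ gridTimeConst N K KY S * δ := fun y => by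
    have h1 := hV.abs_sub_le_grid h hΔtS' hS (n := 1) le_rfl (by simpa using hΔtS') y
    simp only [Nat.cast_one, one_mul, zero_add] at h1
    have h2 : V a y - V b y = (a - b) / Δt * (V Δt y - V 0 y) := by
      rw [hV.initial a ha, hV.initial b hb, hV.apply_zero hΔt]; ring
    rw [h2, abs_mul, abs_div, abs_of_pos hΔt]
    have h3 : |a - b| ≤ Δt := abs_sub_le_of_nonneg_of_le ha.1 ha.2 hb.1 hb.2
    have h4 : |a - b| = δ * δ := (Real.mul_self_sqrt (abs_nonneg _)).symm
    have h5 : δ ≤ √Δt := Real.sqrt_le_sqrt h3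
    have h6 : Δt = √Δt * √Δt := (Real.mul_self_sqrt hΔt.le).symm
    have h7 : 0 < √Δt := Real.sqrt_pos.2 hΔt
    calc |a - b| / Δt * |V Δt y - V 0 y| ≤ |a - b| / Δt * (gridTimeConst N K KY S * √Δt) := by
          gcongr
      _ = gridTimeConst N K KY S * δ * (δ / √Δt) := by
          rw [h4]; nth_rewrite 1 [h6]; field_simp
      _ ≤ gridTimeConst N K KY S * δ * 1 :=
          mul_le_mul_of_nonneg_left ((div_le_one h7).2 h5) (by positivity)
      _ = _ := mul_one _
  have key : ∀ {a b : ℝ}, a ∈ Icc 0 Δt → b ∈ Icc 0 Δt → a + n * Δt ≤ S' → b + n * Δt ≤ S' →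
      √|a - b| = δ → (∀ y, V a y - V b y ≤ gridTimeConst N K KY S * δ) →
      V (a + n * Δt) x - V (b + n * Δt) x ≤ stepTimeConst N K KY S * δ := by
    intro a b ha hb hna hnb hab h0
    have := hV.growth_pair h hV (S := S) (B := gridTimeConst N K KY S + 2 * pairConst K S + 1)
      (δ := δ) (l := 1 / δ) (fun t ht x => hV.abs_le_supConst h hΔtS' hS ht x)
      ha.1 hb.1 hna hnb (by linarith [ha.1]) hδpos.le (by positivity)
      (by rw [one_div_mul_cancel hδpos.ne']) (by linarith)
      (fun j => ⟨j, rfl, by simp [hab]⟩) ?_ x x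
    · rw [show gridTimeConst N K KY S + 2 * pairConst K S + 1 + 1
        = gridTimeConst N K KY S + 2 * pairConst K S + 2 by ring] at this
      simpa [stepTimeConst, pairFactor] using this
    · intro y z
      have h1 := (le_abs_self _).trans (hV.lipschitz h hΔtS' hS ⟨hb.1, hb.2.trans hΔtS'⟩ y z)
      have h2 := h0 y
      have hpos : 0 < 1 / δ := by positivity
      have h3 := mul_le_mul_of_nonneg_left (le_parabola hpos (norm_nonneg (y - z)))
        (show 0 ≤ 2 * pairConst K S by linarith)
      have h4 : δ ≤ 1 / δ * ‖y - z‖ ^ 2 + 1 / (1 / δ) := by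
        rw [one_div_one_div]
        exact le_add_of_nonneg_left (by positivity)
      have h5 := mul_le_mul_of_nonneg_left h4 hgt
      have h6 : 0 ≤ 1 / δ * ‖y - z‖ ^ 2 + 1 / (1 / δ) := by positivity
      linarith
  refine abs_le'.2 ⟨key ha hb hna hnb rfl fun y => (le_abs_self _).trans (hinit y), ?_⟩
  rw [neg_sub]
  refine key hb ha hnb hna (by rw [hδ, abs_sub_comm]) fun y => ?_
  exact (le_abs_self _).trans (by rw [abs_sub_comm]; exact hinit y)

/-- Times in different cells are joined through the right end of the first cell and the left end of
the last one. These are a whole number of steps apart, and none of the three pieces is longer than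
`t - s`. -/
theorem IsSolution.abs_sub_le_time (h : SchemeAssumptions D Y k Δt θ K KY)
    (hV : IsSolution (shiftRHS D Y k Δt θ π) D.g Δt S' V) (hΔtS' : Δt ≤ S') (hS : S' ≤ S)
    {s t : ℝ} (hs : 0 ≤ s) (hst : s ≤ t) (ht : t ≤ S') (x : Sp N) :
    |V t x - V s x| ≤ timeConst N K KY S * √(t - s) := by
  have hΔt := h.Δt_pos
  have hK := h.bounds.nonneg
  have hS0 : 0 ≤ S := by linarith
  have hgt := gridTimeConst_nonneg (N := N) (KY := KY) hK hS0
  have hstc := stepTimeConst_nonneg (N := N) (KY := KY) hK hS0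
  obtain ⟨n, a, ha0, ha1, rfl⟩ := exists_eq_add_mul hΔt hs
  obtain ⟨m, b, hb0, hb1, rfl⟩ := exists_eq_add_mul hΔt (hs.trans hst)
  have hnm : n ≤ m := by
    by_contra! hlt
    have h1 : (m : ℝ) + 1 ≤ n := by exact_mod_cast hlt
    have h2 := mul_le_mul_of_nonneg_right h1 hΔt.le
    linarith
  unfold timeConst
  rcases hnm.eq_or_lt with rfl | hlt
  · have h1 := hV.abs_sub_le_step h hΔtS' hS ⟨hb0, hb1.le⟩ ⟨ha0, ha1.le⟩ ht (hst.trans ht) x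
    rw [add_sub_add_right_eq_sub]
    rw [abs_of_nonneg (by linarith : 0 ≤ b - a)] at h1
    refine h1.trans (mul_le_mul_of_nonneg_right (by linarith) (Real.sqrt_nonneg _))
  · obtain ⟨p, rfl⟩ := Nat.exists_eq_add_of_lt hlt
    push_cast at *
    have hpΔ : 0 ≤ (p : ℝ) * Δt := by positivity
    have hnΔ : 0 ≤ (n : ℝ) * Δt := by positivity
    have h1 := hV.abs_sub_le_step h hΔtS' hS (n := n + p + 1) ⟨hb0, hb1.le⟩ ⟨le_rfl, hΔt.le⟩
      (by push_cast; linarith) (by push_cast; linarith) x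
    have h2 := hV.abs_sub_le_grid h hΔtS' hS (a := Δt + n * Δt) (n := p) (by positivity)
      (by linarith) x
    have h3 := hV.abs_sub_le_step h hΔtS' hS (n := n) ⟨hΔt.le, le_rfl⟩ ⟨ha0, ha1.le⟩
      (by linarith) (by linarith) x
    push_cast at h1
    have e1 : 0 + ((n : ℝ) + p + 1) * Δt = Δt + n * Δt + p * Δt := by ring
    rw [e1, sub_zero, abs_of_nonneg hb0] at h1
    rw [abs_of_nonneg (by linarith : 0 ≤ Δt - a)] at h3
    set q := √(b + (n + p + 1) * Δt - (a + n * Δt)) with hq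
    have r1 : √b ≤ q := Real.sqrt_le_sqrt (by linarith)
    have r2 : √(p * Δt) ≤ q := Real.sqrt_le_sqrt (by linarith)
    have r3 : √(Δt - a) ≤ q := Real.sqrt_le_sqrt (by linarith)
    have s1 := h1.trans (mul_le_mul_of_nonneg_left r1 hstc)
    have s2 := h2.trans (mul_le_mul_of_nonneg_left r2 hgt)
    have s3 := h3.trans (mul_le_mul_of_nonneg_left r3 hstc)
    have t1 := abs_sub_le (V (b + (n + p + 1) * Δt) x) (V (Δt + n * Δt + p * Δt) x)
      (V (a + n * Δt) x)
    have t2 := abs_sub_le (V (Δt + n * Δt + p * Δt) x) (V (Δt + n * Δt) x) (V (a + n * Δt) x)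
    linarith

theorem IsSolution.abs_sub_le (h : SchemeAssumptions D Y k Δt θ K KY)
    (hV : IsSolution (shiftRHS D Y k Δt θ π) D.g Δt S' V) (hΔtS' : Δt ≤ S') (hS : S' ≤ S)
    {s t : ℝ} (hs : s ∈ Icc 0 S') (ht : t ∈ Icc 0 S') (x z : Sp N) :
    |V t x - V s z| ≤ (2 * pairConst K S + timeConst N K KY S) * (‖x - z‖ + √|t - s|) := by
  have hΔt := h.Δt_pos
  have hK := h.bounds.nonneg
  have hS0 : 0 ≤ S := by linarith
  have hpc := one_le_pairConst hK hS0
  have hgt := gridTimeConst_nonneg (N := N) (KY := KY) hK hS0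
  have hstc := stepTimeConst_nonneg (N := N) (KY := KY) hK hS0
  have htc : 0 ≤ timeConst N K KY S := by unfold timeConst; positivity
  have h1 := hV.lipschitz h hΔtS' hS ht x z
  have h2 : |V t z - V s z| ≤ timeConst N K KY S * √|t - s| := by
    rcases le_total s t with hst | hst
    · rw [abs_of_nonneg (sub_nonneg.2 hst)]
      exact hV.abs_sub_le_time h hΔtS' hS hs.1 hst ht.2 z
    · rw [abs_sub_comm, abs_sub_comm t s, abs_of_nonneg (sub_nonneg.2 hst)]
      exact hV.abs_sub_le_time h hΔtS' hS ht.1 hst hs.2 z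
  have h3 := _root_.abs_sub_le (V t x) (V t z) (V s z)
  have h4 : 0 ≤ pairConst K S * √|t - s| := by positivity
  have h5 : 0 ≤ timeConst N K KY S * ‖x - z‖ := by positivity
  linarith

end Regularity

/-! ### Derivatives of convolutions -/

section Convolution

open ContinuousLinearMap
open scoped Convolution

theorem precompR_lsmul {E F : Type*} [NormedAddCommGroup E] [NormedSpace ℝ E]
    [NormedAddCommGroup F] [NormedSpace ℝ F] :
    (lsmul ℝ ℝ : ℝ →L[ℝ] F →L[ℝ] F).precompR E = (lsmul ℝ ℝ : ℝ →L[ℝ] (E →L[ℝ] F) →L[ℝ] _) := by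
  ext; simp

variable {E : Type} [NormedAddCommGroup E] [NormedSpace ℝ E] [FiniteDimensional ℝ E]
  [MeasureSpace E] [BorelSpace E] [(volume : Measure E).IsAddHaarMeasure]

theorem hasFDerivAt_convolution_lsmul {F : Type} [NormedAddCommGroup F] [NormedSpace ℝ F]
    {G : E → ℝ} (hG : Continuous G) {χ : E → F}
    (hχ : ContDiff ℝ ∞ χ) (hc : HasCompactSupport χ) (p : E) :
    HasFDerivAt (G ⋆[lsmul ℝ ℝ, volume] χ) ((G ⋆[lsmul ℝ ℝ, volume] fderiv ℝ χ) p) p := by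
  have := hc.hasFDerivAt_convolution_right (lsmul ℝ ℝ) (hG.locallyIntegrable (μ := volume))
    (hχ.of_le (by exact_mod_cast le_top)) p
  rwa [precompR_lsmul] at this

/-- All derivatives fall on `χ`, so `G` need only be continuous. Values in a general space are
allowed because the induction replaces `χ` by its derivative. -/
theorem norm_iteratedFDeriv_convolution_le (m : ℕ) {F : Type} [NormedAddCommGroup F]
    [NormedSpace ℝ F] {G : E → ℝ} (hG : Continuous G) {χ : E → F} (hχ : ContDiff ℝ ∞ χ)
    (hc : HasCompactSupport χ) {p : E} {δ : ℝ} (hδ : ∀ q ∈ tsupport χ, |G (p - q)| ≤ δ) :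
    ‖iteratedFDeriv ℝ m (G ⋆[lsmul ℝ ℝ, volume] χ) p‖
      ≤ δ * ∫ q, ‖iteratedFDeriv ℝ m χ q‖ := by
  induction m generalizing F χ with
  | zero =>
    simp only [norm_iteratedFDeriv_zero]
    rw [convolution_eq_swap, ← integral_const_mul]
    refine norm_integral_le_of_norm_le ?_ (Filter.Eventually.of_forall fun q => ?_)
    · exact ((hχ.continuous.norm.integrable_of_hasCompactSupport hc.norm)).const_mul δ
    · rw [lsmul_apply, norm_smul, Real.norm_eq_abs]
      by_cases hq : q ∈ tsupport χ
      · exact mul_le_mul_of_nonneg_right (hδ q hq) (norm_nonneg _)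
      · rw [image_eq_zero_of_notMem_tsupport hq]
        simp
  | succ m ih =>
    have hfd : fderiv ℝ (G ⋆[lsmul ℝ ℝ, volume] χ) = G ⋆[lsmul ℝ ℝ, volume] fderiv ℝ χ :=
      funext fun q => (hasFDerivAt_convolution_lsmul hG hχ hc q).fderiv
    simp only [← norm_iteratedFDeriv_fderiv (𝕜 := ℝ) (n := m)]
    rw [hfd]
    exact ih (hχ.fderiv_right (m := ∞) (by simp)) (hc.fderiv ℝ)
      fun q hq => hδ q (tsupport_fderiv_subset ℝ hq)

/-- Since `χ` has mass one, subtracting `c` from `G` only shifts the convolution by `c`. Taking `c =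
G p`, invisible to derivatives, replaces the size of `G` by its oscillation near `p` and so gains a
factor `ε`. -/
theorem convolution_sub_const {G : E → ℝ} (hG : Continuous G) {χ : E → ℝ} (hχ : Continuous χ)
    (hc : HasCompactSupport χ) (h1 : ∫ q, χ q = 1) (c : ℝ) (p : E) :
    (G ⋆[lsmul ℝ ℝ, volume] χ) p = ((fun q => G q - c) ⋆[lsmul ℝ ℝ, volume] χ) p + c := by
  rw [convolution_eq_swap, convolution_eq_swap]
  have i1 : Integrable fun t => lsmul ℝ ℝ (G (p - t)) (χ t) := by
    refine Continuous.integrable_of_hasCompactSupport ?_ ?_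
    · simp only [lsmul_apply]; fun_prop
    · exact hc.smul_left (f := fun t => G (p - t))
  have i2 : Integrable fun t => c * χ t :=
    ((hχ.integrable_of_hasCompactSupport hc)).const_mul c
  have e : ∀ t, lsmul ℝ ℝ (G (p - t) - c) (χ t) = lsmul ℝ ℝ (G (p - t)) (χ t) - c * χ t := by
    intro t; simp
  simp only [e]
  rw [integral_sub i1 i2, integral_const_mul, h1]
  ring

end Convolution

/-! ### Iterated time derivatives -/

section TimeDerivative

instance isAddHaarMeasure_volume_prod {N : ℕ} :
    (volume : Measure (ℝ × Sp N)).IsAddHaarMeasure :=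
  inferInstanceAs ((volume : Measure ℝ).prod (volume : Measure (Sp N))).IsAddHaarMeasure

open ContinuousLinearMap
open scoped Convolution

variable {N : ℕ}

/-- The derivative with respect to the first variable. -/
noncomputable def timeDeriv (f : ℝ × Sp N → ℝ) (p : ℝ × Sp N) : ℝ := fderiv ℝ f p (1, 0)

theorem ContDiff.timeDeriv {f : ℝ × Sp N → ℝ} (hf : ContDiff ℝ ∞ f) :
    ContDiff ℝ ∞ (timeDeriv f) :=
  (hf.fderiv_right (m := ∞) (by simp)).clm_apply contDiff_const

theorem ContDiff.timeDeriv_iterate {f : ℝ × Sp N → ℝ} (hf : ContDiff ℝ ∞ f) (n : ℕ) :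
    ContDiff ℝ ∞ (_root_.timeDeriv^[n] f) := by
  induction n generalizing f with
  | zero => exact hf
  | succ n ih => exact ih hf.timeDeriv

theorem tsupport_timeDeriv_iterate_subset (f : ℝ × Sp N → ℝ) (n : ℕ) :
    tsupport (timeDeriv^[n] f) ⊆ tsupport f := by
  induction n generalizing f with
  | zero => exact subset_rfl
  | succ n ih => exact (ih (timeDeriv f)).trans (tsupport_fderiv_apply_subset ℝ (1, 0))

theorem HasCompactSupport.timeDeriv {f : ℝ × Sp N → ℝ} (hf : HasCompactSupport f) :
    HasCompactSupport (timeDeriv f) := hf.fderiv_apply ℝ (1, 0)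

theorem HasCompactSupport.timeDeriv_iterate {f : ℝ × Sp N → ℝ} (hf : HasCompactSupport f)
    (n : ℕ) : HasCompactSupport (_root_.timeDeriv^[n] f) := by
  induction n generalizing f with
  | zero => exact hf
  | succ n ih => exact ih hf.timeDeriv

theorem deriv_comp_mul_eq_timeDeriv {f : ℝ × Sp N → ℝ} (hf : ContDiff ℝ ∞ f) (a t : ℝ)
    (z : Sp N) : deriv (fun τ => f (a * τ, z)) t = a * timeDeriv f (a * t, z) := by
  have h1 : HasDerivAt (fun τ : ℝ => ((a * τ, z) : ℝ × Sp N)) (a, 0) t := by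
    have := (hasDerivAt_id t).const_mul a
    simpa using this.prodMk (hasDerivAt_const t z)
  have h2 := (hf.differentiable (by simp) (a * t, z)).hasFDerivAt.comp_hasDerivAt t h1
  have e : ((a, 0) : ℝ × Sp N) = a • (1, 0) := by simp
  rw [e, map_smul] at h2
  exact h2.deriv

theorem iteratedDeriv_comp_mul_eq_timeDeriv {f : ℝ × Sp N → ℝ} (hf : ContDiff ℝ ∞ f) (n : ℕ)
    (a t : ℝ) (z : Sp N) :
    iteratedDeriv n (fun τ => f (a * τ, z)) t = a ^ n * timeDeriv^[n] f (a * t, z) := by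
  induction n generalizing t with
  | zero => simp
  | succ n ih =>
    rw [iteratedDeriv_succ, funext ih, deriv_const_mul_field,
      deriv_comp_mul_eq_timeDeriv (hf.timeDeriv_iterate n), Function.iterate_succ_apply', pow_succ]
    ring

theorem norm_iteratedFDeriv_comp_smul_le {f : ℝ × Sp N → ℝ} (hf : ContDiff ℝ ∞ f) (m : ℕ) (τ : ℝ)
    {a : ℝ} (ha : 0 ≤ a) (x : Sp N) :
    ‖iteratedFDeriv ℝ m (fun z => f (τ, a • z)) x‖
      ≤ a ^ m * ‖iteratedFDeriv ℝ m f (τ, a • x)‖ := by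
  set L : Sp N →L[ℝ] ℝ × Sp N := a • ContinuousLinearMap.inr ℝ ℝ (Sp N) with hL
  have e : (fun z => f (τ, a • z)) = (fun p => f ((τ, 0) + p)) ∘ L := by
    funext z; simp [hL]
  have hf' : ContDiff ℝ ∞ fun p => f ((τ, 0) + p) := by fun_prop
  rw [e, L.iteratedFDeriv_comp_right hf' x (i := m) (by exact_mod_cast le_top),
    iteratedFDeriv_comp_add_left]
  refine (ContinuousMultilinearMap.norm_compContinuousLinearMap_le _ _).trans ?_
  have hLn : ‖L‖ ≤ a := by
    rw [hL, norm_smul, Real.norm_of_nonneg ha]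
    exact mul_le_of_le_one_right ha (ContinuousLinearMap.norm_inr_le_one ℝ ℝ (Sp N))
  have ex : (τ, (0 : Sp N)) + L x = (τ, a • x) := by simp [hL]
  rw [ex, Finset.prod_const, Finset.card_univ, Fintype.card_fin, mul_comm]
  gcongr

theorem timeDeriv_convolution {G χ : ℝ × Sp N → ℝ} (hG : Continuous G) (hχ : ContDiff ℝ ∞ χ)
    (hc : HasCompactSupport χ) :
    timeDeriv (G ⋆[lsmul ℝ ℝ, volume] χ) = G ⋆[lsmul ℝ ℝ, volume] timeDeriv χ := by
  funext p
  rw [timeDeriv, (hasFDerivAt_convolution_lsmul hG hχ hc p).fderiv, ← precompR_lsmul]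
  exact convolution_precompR_apply _ hG.locallyIntegrable (hc.fderiv ℝ)
    (hχ.continuous_fderiv (by simp)) p (1, 0)

theorem timeDeriv_iterate_convolution {G χ : ℝ × Sp N → ℝ} (hG : Continuous G)
    (hχ : ContDiff ℝ ∞ χ) (hc : HasCompactSupport χ) (n : ℕ) :
    timeDeriv^[n] (G ⋆[lsmul ℝ ℝ, volume] χ) = G ⋆[lsmul ℝ ℝ, volume] timeDeriv^[n] χ := by
  induction n generalizing χ with
  | zero => rfl
  | succ n ih =>
    rw [Function.iterate_succ_apply, timeDeriv_convolution hG hχ hc,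
      ih hχ.timeDeriv hc.timeDeriv, Function.iterate_succ_apply]

theorem norm_iteratedFDeriv_timeDeriv_add_const (f : ℝ × Sp N → ℝ) (c : ℝ) {m n : ℕ}
    (hmn : 1 ≤ m + n) (p : ℝ × Sp N) :
    ‖iteratedFDeriv ℝ m (timeDeriv^[n] fun q => f q + c) p‖
      = ‖iteratedFDeriv ℝ m (timeDeriv^[n] f) p‖ := by
  have e : fderiv ℝ (fun q => f q + c) = fderiv ℝ f := funext fun q => fderiv_add_const c
  rcases n with _ | n
  · obtain ⟨m, rfl⟩ : ∃ j, m = j + 1 := ⟨m - 1, by omega⟩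
    simp only [Function.iterate_zero, id, ← norm_iteratedFDeriv_fderiv (𝕜 := ℝ) (n := m), e]
  · have : timeDeriv (fun q => f q + c) = timeDeriv f := by
      funext q; simp only [timeDeriv, e]
    rw [Function.iterate_succ_apply, Function.iterate_succ_apply, this]

/-- Derivatives of a mollification of `G` at `p`, in terms of the oscillation `δ` of `G` near
`p`. -/
theorem norm_iteratedFDeriv_timeDeriv_convolution_le {G χ : ℝ × Sp N → ℝ} (hG : Continuous G)
    (hχ : ContDiff ℝ ∞ χ) (hc : HasCompactSupport χ) (h1 : ∫ q, χ q = 1) {p : ℝ × Sp N} {δ : ℝ}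
    (hδ : ∀ q ∈ tsupport χ, |G (p - q) - G p| ≤ δ) {m n : ℕ} (hmn : 1 ≤ m + n) :
    ‖iteratedFDeriv ℝ m (timeDeriv^[n] (G ⋆[lsmul ℝ ℝ, volume] χ)) p‖
      ≤ δ * ∫ q, ‖iteratedFDeriv ℝ m (timeDeriv^[n] χ) q‖ := by
  rw [funext (convolution_sub_const hG hχ.continuous hc h1 (G p)),
    norm_iteratedFDeriv_timeDeriv_add_const _ _ hmn,
    timeDeriv_iterate_convolution (by fun_prop) hχ hc]
  exact norm_iteratedFDeriv_convolution_le m (by fun_prop) (hχ.timeDeriv_iterate n)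
    (hc.timeDeriv_iterate n) fun q hq => hδ q (tsupport_timeDeriv_iterate_subset χ n hq)

end TimeDerivative

/-! ### Averages against a mollifier -/

section Mollifier

variable {N : ℕ} {ρ : ℝ × Sp N → ℝ}

theorem IsMollifier.hasCompactSupport (hρ : IsMollifier ρ) : HasCompactSupport ρ :=
  (isCompact_Icc.prod (isCompact_closedBall 0 1)).of_isClosed_subset (isClosed_tsupport ρ)
    hρ.support

theorem IsMollifier.mem_of_mem_tsupport (hρ : IsMollifier ρ) {p : ℝ × Sp N}
    (hp : p ∈ tsupport ρ) : 0 ≤ p.1 ∧ p.1 ≤ 1 ∧ ‖p.2‖ ≤ 1 := by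
  have := hρ.support hp
  exact ⟨this.1.1, this.1.2, by simpa using this.2⟩

theorem IsMollifier.integrable_mul (hρ : IsMollifier ρ) {f : ℝ × Sp N → ℝ} (hf : Continuous f) :
    Integrable fun p => f p * ρ p :=
  (hf.mul hρ.smooth.continuous).integrable_of_hasCompactSupport hρ.hasCompactSupport.mul_left

theorem IsMollifier.integral_mul_mono (hρ : IsMollifier ρ) {f g : ℝ × Sp N → ℝ}
    (hf : Integrable fun p => f p * ρ p) (hg : Integrable fun p => g p * ρ p)
    (hfg : ∀ p ∈ tsupport ρ, f p ≤ g p) : ∫ p, f p * ρ p ≤ ∫ p, g p * ρ p := by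
  refine integral_mono hf hg fun p => ?_
  by_cases hp : p ∈ tsupport ρ
  · exact mul_le_mul_of_nonneg_right (hfg p hp) (hρ.nonneg p)
  · simp [image_eq_zero_of_notMem_tsupport hp]

theorem IsMollifier.abs_integral_mul_sub_le (hρ : IsMollifier ρ) {f g : ℝ × Sp N → ℝ}
    (hf : Continuous f) (hg : Continuous g) {δ : ℝ}
    (hδ : ∀ p ∈ tsupport ρ, |f p - g p| ≤ δ) :
    |(∫ p, f p * ρ p) - ∫ p, g p * ρ p| ≤ δ := by
  have hc : ∫ p, δ * ρ p = δ := by rw [integral_const_mul, hρ.integral, mul_one]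
  rw [← integral_sub (hρ.integrable_mul hf) (hρ.integrable_mul hg)]
  simp only [← sub_mul]
  rw [abs_le]
  constructor
  · have := hρ.integral_mul_mono (hρ.integrable_mul (continuous_const (y := -δ)))
      (hρ.integrable_mul (hf.sub hg)) fun p hp => neg_le_of_abs_le (hδ p hp)
    simp only [neg_mul, integral_neg, hc] at this
    exact this
  · have := hρ.integral_mul_mono (hρ.integrable_mul (hf.sub hg))
      (hρ.integrable_mul (continuous_const (y := δ))) fun p hp => le_of_abs_le (hδ p hp)
    rwa [hc] at this

theorem IsMollifier.integral_const_mul (hρ : IsMollifier ρ) (c : ℝ) : ∫ p, c * ρ p = c := by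
  rw [MeasureTheory.integral_const_mul, hρ.integral, mul_one]

end Mollifier

/-! ### The mollified solution -/

/-- The extension of `V` from the time interval `[0, S]` that is constant in time outside. -/
noncomputable def clampTime {N : ℕ} (S : ℝ) (V : ℝ → Sp N → ℝ) (t : ℝ) (x : Sp N) : ℝ :=
  V (max 0 (min S t)) x

theorem clampTime_eq {N : ℕ} {S : ℝ} (V : ℝ → Sp N → ℝ) {t : ℝ} (ht : t ∈ Icc 0 S) :
    clampTime S V t = V t := by
  funext x
  rw [clampTime, min_eq_right ht.2, max_eq_right ht.1]

theorem clamp_mem {S : ℝ} (hS : 0 ≤ S) (t : ℝ) : max 0 (min S t) ∈ Icc 0 S :=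
  ⟨le_max_left _ _, max_le hS (min_le_left _ _)⟩

theorem continuous_clampTime {N : ℕ} {S : ℝ} (hS : 0 ≤ S) {V : ℝ → Sp N → ℝ}
    (hV : ContinuousOn (fun p : ℝ × Sp N => V p.1 p.2) (Icc 0 S ×ˢ univ)) :
    Continuous fun p : ℝ × Sp N => clampTime S V p.1 p.2 :=
  hV.comp_continuous (f := fun p : ℝ × Sp N => (max 0 (min S p.1), p.2)) (by fun_prop)
    fun p => ⟨clamp_mem hS p.1, mem_univ _⟩

theorem abs_clampTime_sub_le {N : ℕ} {S H : ℝ} (hS : 0 ≤ S) (hH : 0 ≤ H) {V : ℝ → Sp N → ℝ}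
    (hV : ∀ s ∈ Icc 0 S, ∀ t ∈ Icc 0 S, ∀ x z, |V t x - V s z| ≤ H * (‖x - z‖ + √|t - s|))
    (s t : ℝ) (x z : Sp N) :
    |clampTime S V t x - clampTime S V s z| ≤ H * (‖x - z‖ + √|t - s|) := by
  refine (hV _ (clamp_mem hS s) _ (clamp_mem hS t) x z).trans ?_
  have : |max 0 (min S t) - max 0 (min S s)| ≤ |t - s| := by
    have h1 := abs_max_sub_max_le_abs (min S t) (min S s) 0
    have h2 := abs_min_sub_min_le_max S t S s
    rw [sub_self, abs_zero, max_eq_right (abs_nonneg _)] at h2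
    rw [max_comm 0, max_comm 0]
    exact h1.trans h2
  gcongr

section MollifiedSolution

variable {N : ℕ} {ρ : ℝ × Sp N → ℝ} {T Δt ε : ℝ} {W : ℝ → Sp N → ℝ}

theorem continuous_translate (hW : Continuous fun p : ℝ × Sp N => W p.1 p.2) (a t : ℝ)
    (x : Sp N) : Continuous fun p : ℝ × Sp N => W (t - ε ^ 2 * p.1 + a) (x - ε • p.2) :=
  hW.comp (g := fun p : ℝ × Sp N => W p.1 p.2)
    (f := fun p : ℝ × Sp N => (t - ε ^ 2 * p.1 + a, x - ε • p.2)) (by fun_prop)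

/-- The Jacobian `ε ^ (N + 2)` of the parabolic scaling cancels the normalisation of the mollifier.
Only shifts `s ≤ ε ^ 2` carry mass, so `V` may be replaced by a globally continuous extension `W`.
-/
theorem mollifiedSolution_eq (hρ : IsMollifier ρ) (hε : 0 < ε) {V : ℝ → Sp N → ℝ} {t : ℝ}
    (hVW : ∀ s ∈ Icc 0 (ε ^ 2), V (t - s + Δt + ε ^ 2) = W (t - s + Δt + ε ^ 2))
    (hW : Continuous fun p : ℝ × Sp N => W p.1 p.2) (x : Sp N) :
    mollifiedSolution ρ Δt ε V t x
      = ∫ p : ℝ × Sp N, W (t - ε ^ 2 * p.1 + (Δt + ε ^ 2)) (x - ε • p.2) * ρ p := by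
  have hε2 : 0 < ε ^ 2 := by positivity
  set Φ : ℝ × Sp N → ℝ :=
    fun p => W (t - ε ^ 2 * p.1 + (Δt + ε ^ 2)) (x - ε • p.2) * ρ p with hΦ
  have hinner : ∀ e : Sp N, ∫ s in Ioi (0 : ℝ),
      V (t - s + Δt + ε ^ 2) (x - e) * scaledMollifier ρ ε s e
      = 1 / ε ^ (N + 2) * (ε ^ 2 * ∫ s, Φ (s, ε⁻¹ • e)) := by
    intro e
    have h1 : ∀ s ∈ Ioi (0 : ℝ), V (t - s + Δt + ε ^ 2) (x - e) * scaledMollifier ρ ε s e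
        = 1 / ε ^ (N + 2) * Φ (s / ε ^ 2, ε⁻¹ • e) := by
      intro s hs
      simp only [hΦ, scaledMollifier]
      rw [mul_div_cancel₀ _ hε2.ne', smul_inv_smul₀ hε.ne', ← add_assoc]
      by_cases hp : (s / ε ^ 2, ε⁻¹ • e) ∈ tsupport ρ
      · have := hρ.mem_of_mem_tsupport hp
        rw [hVW s ⟨le_of_lt hs, (div_le_one hε2).1 this.2.1⟩]
        ring
      · rw [image_eq_zero_of_notMem_tsupport hp]
        ring
    rw [setIntegral_congr_fun measurableSet_Ioi h1, ← integral_Ici_eq_integral_Ioi,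
      setIntegral_eq_integral_of_forall_compl_eq_zero, integral_const_mul,
      Measure.integral_comp_div (fun s => Φ (s, ε⁻¹ • e)), abs_of_pos hε2, smul_eq_mul]
    intro s hs
    have hs' : s < 0 := not_le.1 hs
    have hp : (s / ε ^ 2, ε⁻¹ • e) ∉ tsupport ρ := fun hp =>
      (div_neg_of_neg_of_pos hs' hε2).not_ge (hρ.mem_of_mem_tsupport hp).1
    simp [hΦ, image_eq_zero_of_notMem_tsupport hp]
  have hΦi : Integrable Φ := hρ.integrable_mul (continuous_translate hW _ _ _)
  unfold mollifiedSolution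
  simp only [hinner]
  rw [integral_const_mul, integral_const_mul,
    Measure.integral_comp_inv_smul_of_nonneg volume (fun e => ∫ s, Φ (s, e)) hε.le,
    finrank_euclideanSpace_fin, smul_eq_mul, Measure.volume_eq_prod]
  rw [Measure.volume_eq_prod] at hΦi
  rw [integral_prod_symm _ hΦi]
  field_simp
  ring

/-- The mollification as a convolution in rescaled variables. -/
theorem integral_translate_eq_convolution (hε : 0 < ε) (W : ℝ → Sp N → ℝ) (a t : ℝ) (x : Sp N) :
    ∫ p : ℝ × Sp N, W (t - ε ^ 2 * p.1 + a) (x - ε • p.2) * ρ p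
      = convolution (fun q : ℝ × Sp N => W (ε ^ 2 * q.1 + a) (ε • q.2)) ρ
        (ContinuousLinearMap.lsmul ℝ ℝ) volume ((ε ^ 2)⁻¹ * t, ε⁻¹ • x) := by
  have hε2 : 0 < ε ^ 2 := by positivity
  rw [convolution_eq_swap]
  refine integral_congr_ae (Filter.Eventually.of_forall fun p => ?_)
  simp only [Prod.fst_sub, Prod.snd_sub, ContinuousLinearMap.lsmul_apply, smul_eq_mul]
  rw [mul_sub, mul_inv_cancel_left₀ hε2.ne', smul_sub, smul_inv_smul₀ hε.ne']

end MollifiedSolution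

/-! ### Smoothness and derivative bounds of the mollification -/

section Smooth

open Filter Topology

variable {N : ℕ} {ρ : ℝ × Sp N → ℝ} {ε : ℝ} {W : ℝ → Sp N → ℝ}

theorem contDiff_integral_translate (hρ : IsMollifier ρ) (hε : 0 < ε)
    (hW : Continuous fun p : ℝ × Sp N => W p.1 p.2) (a : ℝ) :
    ContDiff ℝ ∞ fun p : ℝ × Sp N =>
      ∫ q : ℝ × Sp N, W (p.1 - ε ^ 2 * q.1 + a) (p.2 - ε • q.2) * ρ q := by
  simp only [integral_translate_eq_convolution hε W a]
  have hG : Continuous fun q : ℝ × Sp N => W (ε ^ 2 * q.1 + a) (ε • q.2) :=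
    hW.comp (g := fun p : ℝ × Sp N => W p.1 p.2)
      (f := fun q : ℝ × Sp N => (ε ^ 2 * q.1 + a, ε • q.2)) (by fun_prop)
  have h1 := hρ.hasCompactSupport.contDiff_convolution_right (n := ⊤)
    (ContinuousLinearMap.lsmul ℝ ℝ) (hG.locallyIntegrable (μ := volume)) hρ.smooth
  exact h1.comp (f := fun p : ℝ × Sp N => ((ε ^ 2)⁻¹ * p.1, ε⁻¹ • p.2)) (by fun_prop)

/-- In the rescaled variables a time derivative costs `ε⁻¹ ^ 2`, a space derivative costs `ε⁻¹`, and
the oscillation over the support of `ρ` is at most `2 * H * ε`. -/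
theorem norm_iteratedFDeriv_integral_translate_le (hρ : IsMollifier ρ) (hε : 0 < ε)
    (hW : Continuous fun p : ℝ × Sp N => W p.1 p.2) {H : ℝ} (hH : 0 ≤ H)
    (hlip : ∀ s t x z, |W t x - W s z| ≤ H * (‖x - z‖ + √|t - s|)) (a : ℝ) {m n : ℕ}
    (hmn : 1 ≤ m + n) (t : ℝ) (x : Sp N) :
    ‖iteratedFDeriv ℝ m (fun z => iteratedDeriv n (fun τ =>
        ∫ q : ℝ × Sp N, W (τ - ε ^ 2 * q.1 + a) (z - ε • q.2) * ρ q) t) x‖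
      ≤ 2 * H * (∫ q, ‖iteratedFDeriv ℝ m (timeDeriv^[n] ρ) q‖)
        * ε ^ (1 - (m : ℤ) - 2 * (n : ℤ)) := by
  simp only [integral_translate_eq_convolution hε W a]
  set G : ℝ × Sp N → ℝ := fun q => W (ε ^ 2 * q.1 + a) (ε • q.2) with hGdef
  have hG : Continuous G :=
    hW.comp (g := fun p : ℝ × Sp N => W p.1 p.2)
      (f := fun q : ℝ × Sp N => (ε ^ 2 * q.1 + a, ε • q.2)) (by fun_prop)
  have hΦ : ContDiff ℝ ∞ (convolution G ρ (ContinuousLinearMap.lsmul ℝ ℝ) volume) :=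
    hρ.hasCompactSupport.contDiff_convolution_right (n := ⊤)
      (ContinuousLinearMap.lsmul ℝ ℝ) (hG.locallyIntegrable (μ := volume)) hρ.smooth
  simp only [iteratedDeriv_comp_mul_eq_timeDeriv hΦ]
  set Φ := convolution G ρ (ContinuousLinearMap.lsmul ℝ ℝ) volume
  have hΦn := hΦ.timeDeriv_iterate n
  have e1 : (fun z : Sp N => ((ε ^ 2)⁻¹) ^ n * timeDeriv^[n] Φ ((ε ^ 2)⁻¹ * t, ε⁻¹ • z))
      = ((ε ^ 2)⁻¹) ^ n • fun z : Sp N => timeDeriv^[n] Φ ((ε ^ 2)⁻¹ * t, ε⁻¹ • z) := rfl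
  have hcd : ContDiff ℝ ∞ fun z : Sp N => timeDeriv^[n] Φ ((ε ^ 2)⁻¹ * t, ε⁻¹ • z) :=
    hΦn.comp (f := fun z : Sp N => ((ε ^ 2)⁻¹ * t, ε⁻¹ • z)) (by fun_prop)
  rw [e1, iteratedFDeriv_const_smul_apply (hcd.contDiffAt.of_le (by exact_mod_cast le_top)),
    norm_smul, Real.norm_of_nonneg (by positivity)]
  have h1 := norm_iteratedFDeriv_comp_smul_le hΦn m ((ε ^ 2)⁻¹ * t)
    (inv_nonneg.2 hε.le) x
  have h2 := norm_iteratedFDeriv_timeDeriv_convolution_le hG hρ.smooth hρ.hasCompactSupport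
    hρ.integral (p := ((ε ^ 2)⁻¹ * t, ε⁻¹ • x)) (δ := 2 * H * ε) (fun q hq => ?_) hmn
  · calc ((ε ^ 2)⁻¹) ^ n * ‖iteratedFDeriv ℝ m
          (fun z => timeDeriv^[n] Φ ((ε ^ 2)⁻¹ * t, ε⁻¹ • z)) x‖
        ≤ ((ε ^ 2)⁻¹) ^ n * (ε⁻¹ ^ m * (2 * H * ε
          * ∫ q, ‖iteratedFDeriv ℝ m (timeDeriv^[n] ρ) q‖)) := by
          gcongr
          refine h1.trans ?_
          gcongr
      _ = _ := by
          have : ε ^ (1 - (m : ℤ) - 2 * (n : ℤ)) = ((ε ^ 2)⁻¹) ^ n * (ε⁻¹ ^ m * ε) := by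
            rw [zpow_sub₀ hε.ne', zpow_sub₀ hε.ne', zpow_one, zpow_natCast, zpow_mul]
            simp only [zpow_natCast, zpow_ofNat, inv_pow]
            field_simp
          rw [this]
          ring
  · obtain ⟨hq0, hq1, hq2⟩ := hρ.mem_of_mem_tsupport hq
    refine (hlip _ _ _ _).trans ?_
    have n1 : ‖ε • (((ε ^ 2)⁻¹ * t, ε⁻¹ • x) - q).2 - ε • ((ε ^ 2)⁻¹ * t, ε⁻¹ • x).2‖ ≤ ε := by
      rw [← smul_sub, Prod.snd_sub, sub_sub_cancel_left, norm_smul, norm_neg,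
        Real.norm_of_nonneg hε.le]
      exact mul_le_of_le_one_right hε.le hq2
    have n2 : √|ε ^ 2 * (((ε ^ 2)⁻¹ * t, ε⁻¹ • x) - q).1 + a
        - (ε ^ 2 * ((ε ^ 2)⁻¹ * t, ε⁻¹ • x).1 + a)| ≤ ε := by
      rw [add_sub_add_right_eq_sub, ← mul_sub, Prod.fst_sub, sub_sub_cancel_left, abs_mul,
        abs_neg, abs_of_nonneg hq0, abs_of_nonneg (sq_nonneg ε)]
      calc √(ε ^ 2 * q.1) ≤ √(ε ^ 2) := Real.sqrt_le_sqrt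
            (mul_le_of_le_one_right (sq_nonneg ε) hq1)
        _ = ε := Real.sqrt_sq hε.le
    have := mul_le_mul_of_nonneg_left (add_le_add n1 n2) hH
    linarith

end Smooth

/-! ### The subsolution property -/

section Subsolution

variable {N P M : ℕ} {A : Type u} {D : Coefficients N P A} {Y : Stencil N M A}
  {k Δt θ K KY ε T : ℝ} {ρ : ℝ × Sp N → ℝ} {V W : ℝ → Sp N → ℝ}

/-- Choosing the translation of the coefficients in the equation for the shaken scheme. -/
theorem IsSolution.shaken_sub_le (h : SchemeAssumptions D Y k Δt θ K KY)
    (hV : IsSolution (shakenRHS D Y k Δt θ ε) D.g Δt (T + Δt + ε ^ 2) V) {t s : ℝ} {e : Sp N}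
    (ht : t ∈ Ioc 0 T) (hs : s ∈ Icc 0 (ε ^ 2)) (he : ‖e‖ ≤ ε) (x : Sp N) (α : A) :
    V (t - s + (Δt + ε ^ 2)) (x - e) - V (t - Δt - s + (Δt + ε ^ 2)) (x - e)
      ≤ Δt * (Lk Y k α (fun z => (1 - θ) * V (t - Δt - s + (Δt + ε ^ 2)) (z - e)
            + θ * V (t - s + (Δt + ε ^ 2)) (z - e)) (thetaTime θ Δt t) x
        + D.c α (thetaTime θ Δt t) x * ((1 - θ) * V (t - Δt - s + (Δt + ε ^ 2)) (x - e)
            + θ * V (t - s + (Δt + ε ^ 2)) (x - e))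
        + D.f α (thetaTime θ Δt t) x) := by
  rw [shakenRHS_eq_shiftRHS] at hV
  -- The advance by `Δt + ε ^ 2` keeps every sampled time at or beyond `Δt`, where the equation
  -- holds, even for `t` close to 0.
  have htt : t - s + (Δt + ε ^ 2) ∈ Icc Δt (T + Δt + ε ^ 2) :=
    ⟨by linarith [ht.1, hs.2], by linarith [ht.2, hs.1]⟩
  have key := hV.sub_le h htt (x - e) (α, ⟨s, hs⟩, ⟨e, by simpa using he⟩)
  have e1 : t - s + (Δt + ε ^ 2) - Δt = t - Δt - s + (Δt + ε ^ 2) := by ring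
  have e2 : thetaTime θ Δt (t - s + (Δt + ε ^ 2)) + (s - Δt - ε ^ 2) = thetaTime θ Δt t := by
    unfold thetaTime; ring
  have e3 : ∀ y, x - e + y = x + y - e := fun y => by abel
  have e4 : thetaMean θ Δt V (t - s + (Δt + ε ^ 2)) = fun z =>
      (1 - θ) * V (t - Δt - s + (Δt + ε ^ 2)) z + θ * V (t - s + (Δt + ε ^ 2)) z := by
    funext z; rw [thetaMean, e1]
  simp only [e1, shiftHam, e2, sub_add_cancel, e4, diffSum] at key
  simp only [e3] at key
  exact key

/-- For a fixed control the inequality for the translates is linear, with coefficients and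
displacements independent of the translation. It can therefore be integrated against `ρ`, and the
infimum is taken only afterwards. -/
theorem isSubsolution_mollifiedSolution [Nonempty A] (h : SchemeAssumptions D Y k Δt θ K KY)
    (hρ : IsMollifier ρ) (hε : 0 < ε)
    (hV : IsSolution (shakenRHS D Y k Δt θ ε) D.g Δt (T + Δt + ε ^ 2) V)
    (hVW : ∀ t ∈ Icc 0 (T + Δt + ε ^ 2), W t = V t)
    (hW : Continuous fun p : ℝ × Sp N => W p.1 p.2) :
    IsSubsolution (schemeRHS D Y k Δt θ) Δt T (mollifiedSolution ρ Δt ε V) := by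
  intro t ht x
  have hΔt := h.Δt_pos
  refine le_ciInf fun α => ?_
  rw [backDiff, div_le_iff₀ hΔt, mul_comm _ Δt]
  set Φ : ℝ → Sp N → ℝ × Sp N → ℝ :=
    fun τ z p => W (τ - ε ^ 2 * p.1 + (Δt + ε ^ 2)) (z - ε • p.2) * ρ p with hΦ
  have hΦi : ∀ τ z, Integrable (Φ τ z) := fun τ z =>
    hρ.integrable_mul (continuous_translate hW _ _ _)
  have hU : ∀ τ ∈ Icc (-Δt) T, ∀ z, mollifiedSolution ρ Δt ε V τ z = ∫ p, Φ τ z p :=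
    fun τ hτ z => mollifiedSolution_eq hρ hε (fun s hs => (hVW _
      ⟨by linarith [hτ.1, hs.2], by linarith [hτ.2, hs.1]⟩).symm) hW z
  have hU1 := hU t ⟨by linarith [ht.1], ht.2⟩
  have hU0 := hU (t - Δt) ⟨by linarith [ht.1], by linarith [ht.2]⟩
  set Ψ : Sp N → ℝ × Sp N → ℝ := fun z p => (1 - θ) * Φ (t - Δt) z p + θ * Φ t z p with hΨ
  have hΨi : ∀ z, Integrable (Ψ z) := fun z =>
    ((hΦi (t - Δt) z).const_mul (1 - θ)).add ((hΦi t z).const_mul θ)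
  have hmean : ∀ z, thetaMean θ Δt (mollifiedSolution ρ Δt ε V) t z = ∫ p, Ψ z p := fun z => by
    rw [thetaMean, hU1, hU0, hΨ, integral_add ((hΦi _ z).const_mul _) ((hΦi _ z).const_mul _),
      integral_const_mul, integral_const_mul]
  set r := thetaTime θ Δt t
  have hdi : ∀ i ∈ (Finset.univ : Finset (Fin M)), Integrable fun p =>
      (Ψ (x + Y.plus α i r x) p - 2 * Ψ x p + Ψ (x + Y.minus α i r x) p) / (2 * k ^ 2) :=
    fun i _ => (((hΨi _).sub ((hΨi x).const_mul 2)).add (hΨi _)).div_const _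
  have hsi : ∀ i, Integrable fun p => Ψ (x + Y.plus α i r x) p - 2 * Ψ x p :=
    fun i => (hΨi _).sub ((hΨi x).const_mul 2)
  have hLi := integrable_finsetSum Finset.univ hdi
  have hci : Integrable fun p => D.c α r x * Ψ x p := (hΨi x).const_mul _
  have hLci : Integrable fun p => ∑ i, (Ψ (x + Y.plus α i r x) p - 2 * Ψ x p
      + Ψ (x + Y.minus α i r x) p) / (2 * k ^ 2) + D.c α r x * Ψ x p := hLi.add hci
  have hfi : Integrable fun p => D.f α r x * ρ p := hρ.integrable_mul continuous_const
  have hL : Lk Y k α (thetaMean θ Δt (mollifiedSolution ρ Δt ε V) t) r x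
      = ∫ p, ∑ i, (Ψ (x + Y.plus α i r x) p - 2 * Ψ x p + Ψ (x + Y.minus α i r x) p)
        / (2 * k ^ 2) := by
    rw [integral_finsetSum _ hdi, Lk]
    refine Finset.sum_congr rfl fun i _ => ?_
    rw [integral_div, integral_add (hsi i) (hΨi _),
      integral_sub (hΨi _) ((hΨi x).const_mul 2), integral_const_mul]
    simp only [hmean]
  rw [hL, hmean, ← integral_const_mul, ← hρ.integral_const_mul (D.f α r x),
    ← integral_add hLi hci, ← integral_add hLci hfi, ← integral_const_mul, hU1, hU0,
    ← integral_sub (hΦi _ _) (hΦi _ _)]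
  refine integral_mono ((hΦi _ _).sub (hΦi _ _)) ((hLci.add hfi).const_mul Δt)
    fun p => ?_
  by_cases hp : p ∈ tsupport ρ
  · obtain ⟨hp0, hp1, hp2⟩ := hρ.mem_of_mem_tsupport hp
    have hs : ε ^ 2 * p.1 ∈ Icc 0 (ε ^ 2) :=
      ⟨by positivity, mul_le_of_le_one_right (sq_nonneg ε) hp1⟩
    have he : ‖ε • p.2‖ ≤ ε := by
      rw [norm_smul, Real.norm_of_nonneg hε.le]
      exact mul_le_of_le_one_right hε.le hp2
    have key := mul_le_mul_of_nonneg_right (hV.shaken_sub_le h ht hs he x α) (hρ.nonneg p)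
    rw [← hVW _ ⟨by linarith [ht.1, hs.2], by linarith [ht.2, hs.1]⟩,
      ← hVW _ ⟨by linarith [ht.1, hs.2], by linarith [ht.2, hs.1]⟩] at key
    simp only [hΨ, hΦ]
    refine le_trans (le_of_eq (by ring)) (key.trans (le_of_eq ?_))
    unfold Lk
    rw [mul_assoc, add_mul, add_mul, Finset.sum_mul]
    congr 2
    congr 1
    · exact Finset.sum_congr rfl fun i _ => by ring
    · ring
  · simp [hΨ, hΦ, image_eq_zero_of_notMem_tsupport hp]

end Subsolution

/-! ### Distance to the shaken scheme and choice of the constants -/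

theorem sqrt_add_sq_le {a ε : ℝ} (ha : 0 ≤ a) (hε : 0 ≤ ε) : √(a + ε ^ 2) ≤ √a + ε := by
  rw [Real.sqrt_le_left (by positivity)]
  nlinarith [Real.sq_sqrt ha, Real.sqrt_nonneg a, mul_nonneg (Real.sqrt_nonneg a) hε]

/-- Distance of the solutions of the scheme and of the shaken scheme. -/
theorem IsSolution.abs_sub_shaken_le {N P M : ℕ} {A : Type u} [Nonempty A]
    {D : Coefficients N P A} {Y : Stencil N M A} {k Δt θ K KY ε T S : ℝ} {V Vε : ℝ → Sp N → ℝ}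
    (h : SchemeAssumptions D Y k Δt θ K KY) (hε : 0 < ε) (hΔtT : Δt ≤ T)
    (hS : T + Δt + ε ^ 2 ≤ S) (hV : IsSolution (schemeRHS D Y k Δt θ) D.g Δt T V)
    (hVε : IsSolution (shakenRHS D Y k Δt θ ε) D.g Δt (T + Δt + ε ^ 2) Vε) {t : ℝ}
    (ht : t ∈ Icc 0 T) (x : Sp N) : |Vε t x - V t x| ≤ pairConst K S * (2 * ε + √Δt) := by
  have hΔt := h.Δt_pos
  have hε2 : 0 < ε ^ 2 := by positivity
  rw [schemeRHS_eq_shiftRHS] at hV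
  rw [shakenRHS_eq_shiftRHS] at hVε
  have hδ : 0 < 2 * ε + √Δt := by positivity
  have hsq := sqrt_add_sq_le hΔt.le hε.le
  have : Nonempty (A × Icc (0 : ℝ) (ε ^ 2) × Metric.closedBall (0 : Sp N) ε) := by
    obtain ⟨α⟩ := ‹Nonempty A›
    exact ⟨α, ⟨0, le_rfl, hε2.le⟩, ⟨0, by simpa using hε.le⟩⟩
  -- A control of the original scheme is matched by the shaken one with zero shifts, which still
  -- lags by `Δt + ε ^ 2` in time; conversely a shaken control is matched by its first component.
  refine abs_le'.2 ⟨hVε.sub_le_of_translation h hV (by linarith) hΔtT (by linarith) hδ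
    (fun α => ⟨(α, ⟨0, le_rfl, hε2.le⟩, ⟨0, by simpa using hε.le⟩), rfl, ?_⟩) ht.1
    (by linarith [ht.2]) ht.2 x, ?_⟩
  · simp only [sub_zero, norm_zero, zero_add]
    rw [show (0 : ℝ) - Δt - ε ^ 2 = -(Δt + ε ^ 2) by ring, abs_neg, abs_of_nonneg (by positivity)]
    linarith
  · rw [neg_sub]
    refine hV.sub_le_of_translation h hVε hΔtT (by linarith) hS hδ
      (fun q => ⟨q.1, rfl, ?_⟩) ht.1 ht.2 (by linarith [ht.2]) x
    have h1 : ‖(0 : Sp N) - q.2.2‖ ≤ ε := by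
      rw [zero_sub, norm_neg]; exact mem_closedBall_zero_iff.1 q.2.2.2
    have h2 : √|0 - ((q.2.1 : ℝ) - Δt - ε ^ 2)| ≤ √(Δt + ε ^ 2) := by
      have := q.2.1.2.1
      have := q.2.1.2.2
      refine Real.sqrt_le_sqrt (abs_le.2 ⟨by linarith, by linarith⟩)
    simp only
    linarith

theorem mainTheorem11 {N P M : ℕ} (T K KY ε₀ : ℝ) (ρ : ℝ × Sp N → ℝ) (hρ : IsMollifier ρ) :
    ∃ (C : ℝ) (C' : ℕ → ℕ → ℝ),
      ∀ (A : Type u) [Nonempty A] (D : Coefficients N P A) (Y : Stencil N M A) (k Δt θ ε : ℝ),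
        0 < k → k < 1 → 0 < Δt → Δt ≤ T → 0 ≤ θ → θ ≤ 1 → 0 < ε → ε ≤ ε₀ →
        AssumptionA1 D K → AssumptionY1 D Y k KY → AssumptionY2 D Y k → CFL D M k Δt θ →
        2 * kZero D * ENNReal.ofReal Δt ≤ 1 → 2 * kOne D * ENNReal.ofReal Δt ≤ 1 →
        ∀ Vε : ℝ → Sp N → ℝ,
          IsSolution (shakenRHS D Y k Δt θ ε) D.g Δt (T + Δt + ε ^ 2) Vε →
          -- smoothness and derivative bounds
          (ContDiffOn ℝ ∞ (fun p : ℝ × Sp N => mollifiedSolution ρ Δt ε Vε p.1 p.2)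
              (Set.Ioo (-Δt) T ×ˢ Set.univ) ∧
            parNorm (Set.Icc (-Δt) T ×ˢ Set.univ) (mollifiedSolution ρ Δt ε Vε)
              ≤ ENNReal.ofReal C ∧
            ∀ m n : ℕ, 1 ≤ m + n → ∀ t ∈ Set.Ioo (-Δt) T, ∀ x : Sp N,
              ‖iteratedFDeriv ℝ m
                  (fun z => iteratedDeriv n (fun τ => mollifiedSolution ρ Δt ε Vε τ z) t) x‖
                ≤ C' m n * ε ^ (1 - (m : ℤ) - 2 * (n : ℤ))) ∧
          -- distance to the solution of the scheme
          (∀ V : ℝ → Sp N → ℝ, IsSolution (schemeRHS D Y k Δt θ) D.g Δt T V →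
            ∀ t ∈ Set.Icc 0 T, ∀ x,
              |mollifiedSolution ρ Δt ε Vε t x - V t x| ≤ C * (ε + √Δt)) ∧
          -- subsolution property
          IsSubsolution (schemeRHS D Y k Δt θ) Δt T (mollifiedSolution ρ Δt ε Vε) := by
  set K' := max K 0
  have hK' : 0 ≤ K' := le_max_right _ _
  -- A horizon containing `T + Δt + ε ^ 2` for all admissible `Δt ≤ T` and `ε ≤ ε₀`.
  set S := 2 * T + ε₀ ^ 2
  set B := supConst K' S
  set G := pairConst K' S
  set H := 2 * G + timeConst N K' KY S with hHdef
  -- `B + H` serves the norm bound; `2 * H` and `2 * G` come from regularity and comparison, each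
  -- applied with the distance `2 * ε + √Δt`.
  refine ⟨B + 2 * H + 2 * G,
    fun m n => 2 * H * ∫ q, ‖iteratedFDeriv ℝ m (timeDeriv^[n] ρ) q‖, ?_⟩
  intro A _ D Y k Δt θ ε hk hk1 hΔt hΔtT hθ0 hθ1 hε hε₀ hA1 hY1 hY2 hcfl h0 h1 Vε hVε
  have h : SchemeAssumptions D Y k Δt θ K' KY :=
    ⟨hk, hk1, hΔt, hθ0, hθ1, hA1.coefficientBounds hΔt h0 h1, hY1, hY2, hcfl⟩
  have hε2 : 0 < ε ^ 2 := by positivity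
  have hSε : T + Δt + ε ^ 2 ≤ S := by
    have : ε ^ 2 ≤ ε₀ ^ 2 := pow_le_pow_left₀ hε.le hε₀ 2
    simp only [S]; linarith
  have hS0 : 0 ≤ S := by linarith
  have hSε0 : 0 ≤ T + Δt + ε ^ 2 := by linarith
  have hB : 0 ≤ B := supConst_nonneg hK'
  have hG : 0 ≤ G := zero_le_one.trans (one_le_pairConst hK' hS0)
  have hH : 0 ≤ H := by
    have := gridTimeConst_nonneg (N := N) (KY := KY) hK' hS0
    have := stepTimeConst_nonneg (N := N) (KY := KY) hK' hS0
    simp only [hHdef, timeConst]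
    positivity
  have hshift := hVε
  rw [shakenRHS_eq_shiftRHS] at hshift
  have : Nonempty (A × Icc (0 : ℝ) (ε ^ 2) × Metric.closedBall (0 : Sp N) ε) := by
    obtain ⟨α⟩ := ‹Nonempty A›
    exact ⟨α, ⟨0, le_rfl, hε2.le⟩, ⟨0, by simpa using hε.le⟩⟩
  have hbd : ∀ t ∈ Icc 0 (T + Δt + ε ^ 2), ∀ x, |Vε t x| ≤ B := fun t ht x =>
    hshift.abs_le_supConst h (by linarith) hSε ht x
  -- `Vε` is controlled only on its own time interval. For `-Δt ≤ t ≤ T` the mollification samples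
  -- no other times, so the extension does not change it.
  set W := clampTime (T + Δt + ε ^ 2) Vε with hWdef
  have hW : Continuous fun p : ℝ × Sp N => W p.1 p.2 := continuous_clampTime hSε0 hVε.continuousOn
  have hWlip : ∀ s t x z, |W t x - W s z| ≤ H * (‖x - z‖ + √|t - s|) :=
    abs_clampTime_sub_le hSε0 hH fun s hs t ht x z =>
      hshift.abs_sub_le h (by linarith) hSε hs ht x z
  have hVW : ∀ t ∈ Icc 0 (T + Δt + ε ^ 2), W t = Vε t := fun t ht => clampTime_eq Vε ht
  have hWbd : ∀ t x, |W t x| ≤ B := fun t x => hbd _ (clamp_mem hSε0 t) x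
  have hU : ∀ t ∈ Icc (-Δt) T, ∀ x, mollifiedSolution ρ Δt ε Vε t x
      = ∫ p : ℝ × Sp N, W (t - ε ^ 2 * p.1 + (Δt + ε ^ 2)) (x - ε • p.2) * ρ p :=
    fun t ht x => mollifiedSolution_eq hρ hε (fun s hs => (hVW _
      ⟨by linarith [ht.1, hs.2], by linarith [ht.2, hs.1]⟩).symm) hW x
  refine ⟨⟨?_, ?_, ?_⟩, ?_, isSubsolution_mollifiedSolution h hρ hε hVε hVW hW⟩
  · exact (contDiff_integral_translate hρ hε hW (Δt + ε ^ 2)).contDiffOn.congr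
      fun p hp => hU p.1 (Ioo_subset_Icc_self hp.1) p.2
  · refine (parNorm_le_of_bounds hB hH ?_ ?_).trans
      (ENNReal.ofReal_le_ofReal (show B + H ≤ B + 2 * H + 2 * G by linarith))
    · intro t x htx
      rw [hU t htx.1 x]
      have := hρ.abs_integral_mul_sub_le (continuous_translate (ε := ε) hW (Δt + ε ^ 2) t x)
        continuous_const (δ := B) (g := fun _ => 0) fun p _ => by rw [sub_zero]; exact hWbd _ _
      simpa using this
    · intro t x s z htx hsz
      rw [hU t htx.1 x, hU s hsz.1 z]
      refine hρ.abs_integral_mul_sub_le (continuous_translate hW _ _ _)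
        (continuous_translate hW _ _ _) fun p _ => (hWlip _ _ _ _).trans (le_of_eq ?_)
      rw [sub_sub_sub_cancel_right, add_sub_add_right_eq_sub, sub_sub_sub_cancel_right]
  · intro m n hmn t ht x
    have e : (fun z => iteratedDeriv n (fun τ => mollifiedSolution ρ Δt ε Vε τ z) t)
        = fun z => iteratedDeriv n (fun τ => ∫ q : ℝ × Sp N,
          W (τ - ε ^ 2 * q.1 + (Δt + ε ^ 2)) (z - ε • q.2) * ρ q) t := by
      funext z
      refine Filter.EventuallyEq.iteratedDeriv_eq n ?_
      filter_upwards [Icc_mem_nhds ht.1 ht.2] with τ hτ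
      exact hU τ hτ z
    rw [e]
    exact norm_iteratedFDeriv_integral_translate_le hρ hε hW hH hWlip _ hmn t x
  · intro V hV t ht x
    have hVVε := hV.abs_sub_shaken_le h hε hΔtT hSε hVε ht x
    have hUV : |mollifiedSolution ρ Δt ε Vε t x - Vε t x| ≤ H * (2 * ε + √Δt) := by
      rw [hU t ⟨by linarith [ht.1], ht.2⟩ x, ← hVW t ⟨ht.1, by linarith [ht.2]⟩,
        ← hρ.integral_const_mul (W t x)]
      refine hρ.abs_integral_mul_sub_le (continuous_translate hW _ _ _) continuous_const
        fun p hp => (hWlip _ _ _ _).trans (mul_le_mul_of_nonneg_left ?_ hH)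
      obtain ⟨hp0, hp1, hp2⟩ := hρ.mem_of_mem_tsupport hp
      have n1 : ‖x - ε • p.2 - x‖ ≤ ε := by
        rw [sub_sub_cancel_left, norm_neg, norm_smul, Real.norm_of_nonneg hε.le]
        exact mul_le_of_le_one_right hε.le hp2
      have n2 : √|t - ε ^ 2 * p.1 + (Δt + ε ^ 2) - t| ≤ √(Δt + ε ^ 2) := by
        have a1 : 0 ≤ ε ^ 2 * p.1 := by positivity
        have a2 : ε ^ 2 * p.1 ≤ ε ^ 2 := mul_le_of_le_one_right hε2.le hp1
        exact Real.sqrt_le_sqrt (abs_le.2 ⟨by linarith, by linarith⟩)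
      have n3 := sqrt_add_sq_le hΔt.le hε.le
      linarith
    have h2 := abs_sub_le (mollifiedSolution ρ Δt ε Vε t x) (Vε t x) (V t x)
    have h3 : 0 ≤ B * (ε + √Δt) := by positivity
    have h4 : 0 ≤ H * √Δt := by positivity
    have h5 : 0 ≤ G * √Δt := by positivity
    linarith
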